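/- Let $s\ge 2$ be an integer and let $\mathbb Z_s=\{\sum_{j\ge 0}x_js^j : 0\le x_j\le s-1\}$ be the space of $s$-adic integers with the product topology of the digits; natural numbers are elements of $\mathbb Z_s$ through their base $s$ expansions. Let $\mathcal V=\{(n,x) : n\ge 0,\ 0\le x<s^n\}$ and let $H=\ell^2(\mathcal V)$ with canonical basis $\{E_{(n,x)}\}$. For $f\in C(\mathbb Z_s)$ define $M_fE_{(n,x)}=f(x)E_{(n,x)}$; this is a faithful representation of $C(\mathbb Z_s)$. Let $W$ be the Serre shift, the isometry of $H$ given by $$WE_{(n,x)}=\frac1{\sqrt s}\sum_{j=0}^{s-1}E_{(n+1,\,x+js^n)} ,$$ and let $A_W=C^*(W,M_f\mid f\in C(\mathbb Z_s))\subseteq B(H)$. For $\theta\in\mathbb R$ let $\mathcal U_\theta$ be the unitary $\mathcal U_\theta E_{(n,x)}=e^{2\pi in\theta}E_{(n,x)}$, and let $I_W$ be the set of gauge invariant compact operators, that is, of the compact operators $a$ on $H$ with $\mathcal U_\theta a\,\mathcal U_\theta^{-1}=a$ for all $\theta$. Let $\mathcal I_W=C^*(aW^n\mid a\in I_W,\ n=0,1,2,\dots)$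 be the (not necessarily unital) $C^*$-algebra generated by these operators. Then $\mathcal I_W$ is a closed two-sided ideal of $A_W$, and there is an isomorphism of $C^*$-algebras (an isometric $*$-isomorphism) $$A_W/\mathcal I_W\;\cong\;\mathcal T\otimes C(\mathbb Z_s),$$ where $\mathcal T$ is the Toeplitz algebra, that is, the $C^*$-algebra generated by the unilateral shift on $\ell^2(\mathbb Z_{\ge 0})$, and $\otimes$ is the spatial (minimal) tensor product of $C^*$-algebras. -/

import Mathlib

open scoped TensorProduct ENNReal

noncomputable section

/-! ## Quotients of `*`-rings by two-sided `*`-ideals -/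

/-- An ideal is a `*`-ideal if it is closed under the involution. -/
class IsStarIdeal {A : Type*} [Ring A] [StarRing A] (I : Ideal A) : Prop where
  star_mem : ∀ {a : A}, a ∈ I → star a ∈ I

section StarQuotient

variable {A : Type*} [Ring A] [StarRing A] (I : Ideal A) [I.IsTwoSided] [IsStarIdeal I]

/-- The involution `a + I ↦ a* + I` on the quotient `A ⧸ I`. -/
instance quotientStar : Star (A ⧸ I) where
  star := Quotient.map' star (by
    intro a b h
    rw [Submodule.quotientRel_def] at h ⊢
    rw [← star_sub]
    exact IsStarIdeal.star_mem h)

theorem quotient_star_mk (a : A) :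
    star (Ideal.Quotient.mk I a) = Ideal.Quotient.mk I (star a) := rfl

instance quotientStarRing : StarRing (A ⧸ I) where
  star_involutive x := by
    obtain ⟨a, rfl⟩ := Ideal.Quotient.mk_surjective x
    simp [quotient_star_mk]
  star_mul x y := by
    obtain ⟨a, rfl⟩ := Ideal.Quotient.mk_surjective x
    obtain ⟨b, rfl⟩ := Ideal.Quotient.mk_surjective y
    rw [← map_mul, quotient_star_mk, star_mul, map_mul, quotient_star_mk, quotient_star_mk]
  star_add x y := by
    obtain ⟨a, rfl⟩ := Ideal.Quotient.mk_surjective x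
    obtain ⟨b, rfl⟩ := Ideal.Quotient.mk_surjective y
    rw [← map_add, quotient_star_mk, star_add, map_add, quotient_star_mk, quotient_star_mk]

end StarQuotient

/-! ## Operators on `ℓ²(ι)` -/

/-- The Hilbert space `ℓ²(ι)`. -/
abbrev L2 (ι : Type*) : Type _ := lp (fun _ : ι => ℂ) 2

/-- The canonical basis vector `E_i` of `ℓ²(ι)`. -/
def basisVec {ι : Type*} [DecidableEq ι] (i : ι) : L2 ι := lp.single 2 i 1

theorem orthonormal_basisVec {ι : Type*} [DecidableEq ι] :
    Orthonormal ℂ (basisVec : ι → L2 ι) := by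
  rw [orthonormal_iff_ite]
  intro i j
  simp only [basisVec, lp.inner_single_left]
  by_cases h : i = j
  · subst h; simp
  · simp [h, lp.single_apply]

/-- Two bounded operators that agree on the canonical basis are equal. -/
theorem ext_basisVec {ι : Type*} [DecidableEq ι] {a b : L2 ι →L[ℂ] L2 ι}
    (h : ∀ i, a (basisVec i) = b (basisVec i)) : a = b := by
  refine lp.ext_continuousLinearMap (by simp) fun i => ?_
  ext
  exact congrArg (fun ξ : L2 ι => (ξ : ι → ℂ) _) (h i)

/-- The isometry of `ℓ²(ι)` that sends `E_i` to `w i`, for an orthonormal family `w`. -/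
def isometryOfOrthonormal {ι : Type*} {w : ι → L2 ι} (hw : Orthonormal ℂ w) :
    L2 ι →ₗᵢ[ℂ] L2 ι :=
  hw.orthogonalFamily.linearIsometry

theorem isometryOfOrthonormal_basisVec {ι : Type*} [DecidableEq ι] {w : ι → L2 ι}
    (hw : Orthonormal ℂ w) (i : ι) : isometryOfOrthonormal hw (basisVec i) = w i := by
  simp [isometryOfOrthonormal, basisVec, OrthogonalFamily.linearIsometry_apply_single]

/-- The diagonal operator `E_i ↦ d i • E_i`, for a bounded function `d`. -/
def diagOp {ι : Type*} (d : ι → ℂ) {C : ℝ} (hC : 0 ≤ C) (hd : ∀ i, ‖d i‖ ≤ C) :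
    L2 ι →L[ℂ] L2 ι :=
  lp.mapCLM 2 (fun i => d i • ContinuousLinearMap.id ℂ ℂ) hC
    (fun i => by simpa [norm_smul] using hd i)

theorem diagOp_apply {ι : Type*} (d : ι → ℂ) {C : ℝ} (hC : 0 ≤ C) (hd : ∀ i, ‖d i‖ ≤ C)
    (ξ : L2 ι) (i : ι) : diagOp d hC hd ξ i = d i * ξ i := by
  simp [diagOp]

theorem diagOp_basisVec {ι : Type*} [DecidableEq ι] (d : ι → ℂ) {C : ℝ} (hC : 0 ≤ C)
    (hd : ∀ i, ‖d i‖ ≤ C) (i : ι) : diagOp d hC hd (basisVec i) = d i • basisVec i := by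
  ext j
  rw [diagOp_apply]
  by_cases h : j = i
  · subst h; simp
  · simp [basisVec, lp.single_apply, h]

theorem star_diagOp {ι : Type*} (d e : ι → ℂ) {C D : ℝ} (hC : 0 ≤ C) (hd : ∀ i, ‖d i‖ ≤ C)
    (hD : 0 ≤ D) (he : ∀ i, ‖e i‖ ≤ D) (h : ∀ i, star (d i) = e i) :
    star (diagOp d hC hd) = diagOp e hD he := by
  rw [ContinuousLinearMap.star_eq_adjoint, eq_comm, ContinuousLinearMap.eq_adjoint_iff]
  intro ξ η
  simp only [lp.inner_eq_tsum]
  refine tsum_congr fun i => ?_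
  simp only [diagOp_apply, ← h i]
  simp
  ring

/-! ## The Toeplitz algebra -/

theorem orthonormal_shift : Orthonormal ℂ (fun k : ℕ => (basisVec (k + 1) : L2 ℕ)) :=
  orthonormal_basisVec.comp (fun k : ℕ => k + 1) (fun _ _ h => Nat.succ_injective h)

/-- The unilateral shift `E_k ↦ E_{k+1}` on `ℓ²(ℤ_{≥0})`. -/
def unilateralShift : L2 ℕ →L[ℂ] L2 ℕ :=
  (isometryOfOrthonormal orthonormal_shift).toContinuousLinearMap

/-- The Toeplitz algebra `𝒯`: the `C*`-algebra of operators on `ℓ²(ℤ_{≥0})` generated by the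
unilateral shift. -/
def toeplitzAlgebra : StarSubalgebra ℂ (L2 ℕ →L[ℂ] L2 ℕ) :=
  (StarAlgebra.adjoin ℂ {unilateralShift}).topologicalClosure

/-! ## The spatial tensor product of represented `C*`-algebras -/

section SpatialTensor

variable {H K : Type*} [NormedAddCommGroup H] [InnerProductSpace ℂ H] [CompleteSpace H]
  [NormedAddCommGroup K] [InnerProductSpace ℂ K]

/-- The Hilbert space tensor product: the completion of the algebraic tensor product with its
inner product `⟪x ⊗ y, x' ⊗ y'⟫ = ⟪x, x'⟫ * ⟪y, y'⟫`. -/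
def HilbertTensor (H K : Type*) [NormedAddCommGroup H] [InnerProductSpace ℂ H]
    [NormedAddCommGroup K] [InnerProductSpace ℂ K] : Type _ :=
  UniformSpace.Completion (H ⊗[ℂ] K)

instance : NormedAddCommGroup (HilbertTensor H K) :=
  inferInstanceAs (NormedAddCommGroup (UniformSpace.Completion (H ⊗[ℂ] K)))

instance : InnerProductSpace ℂ (HilbertTensor H K) :=
  inferInstanceAs (InnerProductSpace ℂ (UniformSpace.Completion (H ⊗[ℂ] K)))

instance : CompleteSpace (HilbertTensor H K) :=
  inferInstanceAs (CompleteSpace (UniformSpace.Completion (H ⊗[ℂ] K)))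

/-- The elementary tensor `x ⊗ y` in the Hilbert space tensor product. -/
def HilbertTensor.tmul (x : H) (y : K) : HilbertTensor H K :=
  ((x ⊗ₜ[ℂ] y : H ⊗[ℂ] K) : UniformSpace.Completion (H ⊗[ℂ] K))

theorem inner_rTensor_left (a : H →L[ℂ] H) (z w : H ⊗[ℂ] K) :
    inner ℂ ((a : H →ₗ[ℂ] H).rTensor K z) w
      = inner ℂ z (((star a : H →L[ℂ] H) : H →ₗ[ℂ] H).rTensor K w) := by
  induction z using TensorProduct.induction_on with
  | zero => simp
  | add z₁ z₂ h₁ h₂ => rw [map_add, inner_add_left, inner_add_left, h₁, h₂]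
  | tmul x y =>
    induction w using TensorProduct.induction_on with
    | zero => simp
    | add w₁ w₂ h₁ h₂ => rw [map_add, inner_add_right, inner_add_right, h₁, h₂]
    | tmul x' y' =>
      simp [ContinuousLinearMap.star_eq_adjoint, ContinuousLinearMap.adjoint_inner_right]

/-- The amplification `a ⊗ 1` of a bounded operator is bounded on the algebraic tensor product. -/
theorem norm_rTensor_apply_le (a : H →L[ℂ] H) (z : H ⊗[ℂ] K) :
    ‖(a : H →ₗ[ℂ] H).rTensor K z‖ ≤ ‖a‖ * ‖z‖ := by
  have h1 : star a * a ≤ algebraMap ℝ (H →L[ℂ] H) (‖a‖ ^ 2) :=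
    CStarAlgebra.star_mul_le_algebraMap_norm_sq
  obtain ⟨c, hc⟩ := CStarAlgebra.nonneg_iff_eq_star_mul_self.mp (sub_nonneg.mpr h1)
  have key : ∀ b : H →L[ℂ] H, inner ℂ ((b : H →ₗ[ℂ] H).rTensor K z)
      ((b : H →ₗ[ℂ] H).rTensor K z)
        = inner ℂ z (((star b * b : H →L[ℂ] H) : H →ₗ[ℂ] H).rTensor K z) := by
    intro b
    rw [inner_rTensor_left, ← LinearMap.comp_apply, ← LinearMap.rTensor_comp]
    rfl
  have h2 : (((star c * c : H →L[ℂ] H) : H →ₗ[ℂ] H).rTensor K z)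
      = ((‖a‖ ^ 2 : ℝ) : ℂ) • z - ((star a * a : H →L[ℂ] H) : H →ₗ[ℂ] H).rTensor K z := by
    rw [← hc]
    have : ((algebraMap ℝ (H →L[ℂ] H) (‖a‖ ^ 2) - star a * a : H →L[ℂ] H) : H →ₗ[ℂ] H)
        = ((‖a‖ ^ 2 : ℝ) : ℂ) • LinearMap.id - ((star a * a : H →L[ℂ] H) : H →ₗ[ℂ] H) := by
      ext x
      simp only [Algebra.algebraMap_eq_smul_one, ContinuousLinearMap.coe_coe,
        _root_.sub_apply, _root_.smul_apply, LinearMap.sub_apply,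
        LinearMap.smul_apply, LinearMap.id_apply]
      rw [Complex.coe_smul]
      rfl
    rw [this, LinearMap.rTensor_sub, LinearMap.rTensor_smul]
    simp
  have h3 : ‖(a : H →ₗ[ℂ] H).rTensor K z‖ ^ 2 + ‖(c : H →ₗ[ℂ] H).rTensor K z‖ ^ 2
      = ‖a‖ ^ 2 * ‖z‖ ^ 2 := by
    have := key c
    have e : inner ℂ z (((‖a‖ ^ 2 : ℝ) : ℂ) • z) = ((‖a‖ ^ 2 : ℝ) : ℂ) * inner ℂ z z := by
      rw [TensorProduct.inner_def, map_smul]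
      rfl
    have hn : ∀ w : H ⊗[ℂ] K, inner ℂ w w = ((‖w‖ ^ 2 : ℝ) : ℂ) := fun w =>
      (inner_self_eq_norm_sq_to_K (𝕜 := ℂ) w).trans (Complex.ofReal_pow _ _).symm
    rw [h2, inner_sub_right, ← key a, e, hn, hn, hn, Complex.ofReal_pow, Complex.ofReal_pow,
      Complex.ofReal_pow, Complex.ofReal_pow] at this
    have h4 : ((‖(a : H →ₗ[ℂ] H).rTensor K z‖ ^ 2 + ‖(c : H →ₗ[ℂ] H).rTensor K z‖ ^ 2 : ℝ) : ℂ)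
        = ((‖a‖ ^ 2 * ‖z‖ ^ 2 : ℝ) : ℂ) := by
      push_cast
      linear_combination this
    exact_mod_cast h4
  refine le_of_sq_le_sq ?_ (by positivity)
  nlinarith [sq_nonneg ‖(c : H →ₗ[ℂ] H).rTensor K z‖]

variable [CompleteSpace K]

theorem norm_lTensor_apply_le (b : K →L[ℂ] K) (z : H ⊗[ℂ] K) :
    ‖(b : K →ₗ[ℂ] K).lTensor H z‖ ≤ ‖b‖ * ‖z‖ := by
  have h := norm_rTensor_apply_le b (TensorProduct.comm ℂ H K z)
  have h1 : (b : K →ₗ[ℂ] K).rTensor H (TensorProduct.comm ℂ H K z)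
      = TensorProduct.comm ℂ H K ((b : K →ₗ[ℂ] K).lTensor H z) := by
    clear h
    induction z using TensorProduct.induction_on with
    | zero => simp
    | add z₁ z₂ h₁ h₂ => rw [map_add, map_add, map_add, map_add, h₁, h₂]
    | tmul x y => simp
  rw [h1] at h
  have h2 : ∀ w : H ⊗[ℂ] K, ‖TensorProduct.comm ℂ H K w‖ = ‖w‖ :=
    fun w => (TensorProduct.commIsometry ℂ H K).norm_map w
  rwa [h2, h2] at h

/-- The algebraic tensor product of two bounded operators, as a bounded operator. -/
def opTensorAlg (a : H →L[ℂ] H) (b : K →L[ℂ] K) : H ⊗[ℂ] K →L[ℂ] H ⊗[ℂ] K :=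
  LinearMap.mkContinuous (TensorProduct.map (a : H →ₗ[ℂ] H) (b : K →ₗ[ℂ] K)) (‖a‖ * ‖b‖) (by
    intro z
    have : TensorProduct.map (a : H →ₗ[ℂ] H) (b : K →ₗ[ℂ] K) z
        = (a : H →ₗ[ℂ] H).rTensor K ((b : K →ₗ[ℂ] K).lTensor H z) := by
      rw [← LinearMap.comp_apply, LinearMap.rTensor_comp_lTensor]
    rw [this, mul_assoc]
    exact (norm_rTensor_apply_le a _).trans
      (mul_le_mul_of_nonneg_left (norm_lTensor_apply_le b z) (norm_nonneg a)))

/-- The operator `a ⊗ b` on the Hilbert space tensor product. -/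
def opTensor (a : H →L[ℂ] H) (b : K →L[ℂ] K) : HilbertTensor H K →L[ℂ] HilbertTensor H K :=
  (opTensorAlg a b).completion

theorem opTensor_tmul (a : H →L[ℂ] H) (b : K →L[ℂ] K) (x : H) (y : K) :
    opTensor a b (HilbertTensor.tmul x y) = HilbertTensor.tmul (a x) (b y) :=
  (opTensorAlg a b).completion_apply_coe (x ⊗ₜ[ℂ] y)

/-- The spatial (minimal) `C*`-tensor product `A ⊗ B` of two unital `C*`-algebras given with
faithful representations `π` and `σ`: the `C*`-algebra of operators on the Hilbert space tensor
product generated by the operators `π a ⊗ σ b`. -/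
def spatialTensorProduct {A B : Type*} [Semiring A] [Algebra ℂ A] [Star A] [Semiring B]
    [Algebra ℂ B] [Star B] (π : A →⋆ₐ[ℂ] (H →L[ℂ] H)) (σ : B →⋆ₐ[ℂ] (K →L[ℂ] K)) :
    StarSubalgebra ℂ (HilbertTensor H K →L[ℂ] HilbertTensor H K) :=
  (StarAlgebra.adjoin ℂ
    (Set.range fun p : A × B => opTensor (π p.1) (σ p.2))).topologicalClosure

end SpatialTensor

/-! ## The `s`-adic integers and the balls in them -/

/-- The space `ℤ_s` of `s`-adic integers `∑ x_j s^j`, given by their digits `x_j`. -/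
def SAdic (s : ℕ) : Type := ℕ → Fin s

/-- `ℤ_s` carries the product topology. -/
instance (s : ℕ) : TopologicalSpace (SAdic s) := inferInstanceAs (TopologicalSpace (ℕ → Fin s))

instance (s : ℕ) : CompactSpace (SAdic s) := inferInstanceAs (CompactSpace (ℕ → Fin s))

instance (s : ℕ) : T2Space (SAdic s) := inferInstanceAs (T2Space (ℕ → Fin s))

/-- A natural number as an `s`-adic integer, through its base `s` expansion. -/
def SAdic.ofNat (s : ℕ) [NeZero s] (x : ℕ) : SAdic s := fun j => Fin.ofNat s (x / s ^ j)

/-- Every finite string of digits is the initial part of the expansion of a natural number. -/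
theorem SAdic.exists_nat (s : ℕ) [NeZero s] (n : ℕ) (x : SAdic s) :
    ∃ m < s ^ n, ∀ i < n, SAdic.ofNat s m i = x i := by
  induction n generalizing x with
  | zero => exact ⟨0, by simp, by simp⟩
  | succ n ih =>
    obtain ⟨m, hm, h⟩ := ih (fun i => x (i + 1))
    refine ⟨x 0 + s * m, ?_, fun i hi => Fin.ext ?_⟩
    · have h1 := (x 0).2
      have h2 : s * (m + 1) ≤ s * s ^ n := Nat.mul_le_mul_left _ hm
      rw [pow_succ']
      linarith [mul_add s m 1]
    · change (x 0 + s * m) / s ^ i % s = x i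
      cases i with
      | zero => simp [Nat.mod_eq_of_lt (x 0).2]
      | succ i =>
        have h3 : m / s ^ i % s = x (i + 1) := congrArg Fin.val (h i (by omega))
        rw [pow_succ', ← Nat.div_div_eq_div_mul,
          Nat.add_mul_div_left _ _ (Nat.pos_of_ne_zero (NeZero.ne s)),
          Nat.div_eq_of_lt (x 0).2, zero_add, h3]

/-- The set `𝒱` of balls in `ℤ_s`: the ball of radius `s⁻ⁿ` around `x` is the pair `(n, x)`,
where `0 ≤ x < sⁿ`. -/
abbrev Ball (s : ℕ) : Type := Σ n : ℕ, Fin (s ^ n)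

/-- The ball `(n + 1, x + j sⁿ)`, for a ball `(n, x)` and `0 ≤ j < s`. -/
def Ball.child {s : ℕ} (v : Ball s) (j : Fin s) : Ball s :=
  ⟨v.1 + 1, ⟨v.2 + j * s ^ v.1, by
    have h1 := v.2.2
    have h2 : ((j : ℕ) + 1) * s ^ v.1 ≤ s * s ^ v.1 := Nat.mul_le_mul_right _ j.2
    rw [pow_succ']
    linarith [add_mul (j : ℕ) 1 (s ^ v.1)]⟩⟩

theorem Ball.child_injective {s : ℕ} {v w : Ball s} {j k : Fin s}
    (h : v.child j = w.child k) : v = w ∧ j = k := by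
  obtain ⟨n, x⟩ := v
  obtain ⟨m, y⟩ := w
  have h1 : n = m := by
    have := congrArg Sigma.fst h
    simpa [Ball.child] using this
  subst h1
  have h2 : (x : ℕ) + j * s ^ n = y + k * s ^ n := by
    simpa [Ball.child] using h
  have hx : ((x : ℕ) + j * s ^ n) % s ^ n = x := by
    rw [Nat.add_mul_mod_self_right, Nat.mod_eq_of_lt x.2]
  have hy : ((y : ℕ) + k * s ^ n) % s ^ n = y := by
    rw [Nat.add_mul_mod_self_right, Nat.mod_eq_of_lt y.2]
  have hxy : x = y := Fin.ext (by rw [← hx, ← hy, h2])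
  subst hxy
  refine ⟨rfl, Fin.ext ?_⟩
  have hpos : 0 < s ^ n := lt_of_le_of_lt (Nat.zero_le _) x.2
  exact Nat.eq_of_mul_eq_mul_right hpos (by omega)

/-! ## The Serre shift algebra -/

/-- The operator `M_f E_{(n,x)} = f(x) E_{(n,x)}` on `H = ℓ²(𝒱)`, for `f ∈ C(ℤ_s)`. -/
def mulOp (s : ℕ) [NeZero s] (f : C(SAdic s, ℂ)) : L2 (Ball s) →L[ℂ] L2 (Ball s) :=
  diagOp (fun v => f (SAdic.ofNat s v.2)) (norm_nonneg f) (fun _ => f.norm_coe_le_norm _)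

theorem mulOp_basisVec (s : ℕ) [NeZero s] (f : C(SAdic s, ℂ)) (v : Ball s) :
    mulOp s f (basisVec v) = f (SAdic.ofNat s v.2) • basisVec v :=
  diagOp_basisVec _ (norm_nonneg f) _ v

theorem star_mulOp (s : ℕ) [NeZero s] (f : C(SAdic s, ℂ)) :
    star (mulOp s f) = mulOp s (star f) :=
  star_diagOp _ _ (norm_nonneg f) _ (norm_nonneg (star f)) _ (fun _ => rfl)

/-- The representation `f ↦ M_f` of `C(ℤ_s)` on `H = ℓ²(𝒱)`. -/
def mulRep (s : ℕ) [NeZero s] : C(SAdic s, ℂ) →⋆ₐ[ℂ] (L2 (Ball s) →L[ℂ] L2 (Ball s)) where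
  toFun := mulOp s
  map_one' := ext_basisVec fun v => by
    rw [mulOp_basisVec, ContinuousMap.one_apply, one_smul]
    rfl
  map_mul' f g := ext_basisVec fun v => by
    change _ = mulOp s f (mulOp s g (basisVec v))
    rw [mulOp_basisVec, mulOp_basisVec, map_smul, mulOp_basisVec, smul_smul,
      ContinuousMap.mul_apply, mul_comm]
  map_zero' := ext_basisVec fun v => by
    rw [mulOp_basisVec, ContinuousMap.zero_apply, zero_smul]
    rfl
  map_add' f g := ext_basisVec fun v => by
    change _ = mulOp s f (basisVec v) + mulOp s g (basisVec v)
    rw [mulOp_basisVec, mulOp_basisVec, mulOp_basisVec, ← add_smul, ContinuousMap.add_apply]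
  commutes' c := ext_basisVec fun v => by
    rw [mulOp_basisVec, Algebra.algebraMap_eq_smul_one]
    simp
  map_star' f := (star_mulOp s f).symm

/-- The representation `f ↦ M_f` is faithful. -/
theorem mulRep_injective (s : ℕ) [NeZero s] : Function.Injective (mulRep s) := by
  intro f g hfg
  ext x
  choose m hm h using fun n => SAdic.exists_nat s n x
  have hlim : Filter.Tendsto (fun n => SAdic.ofNat s (m n)) Filter.atTop (nhds x) := by
    refine tendsto_pi_nhds.mpr fun i => ?_
    refine tendsto_const_nhds.congr' ?_
    filter_upwards [Filter.eventually_gt_atTop i] with n hn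
    exact (h n i hn).symm
  refine tendsto_nhds_unique ((f.continuous.tendsto x).comp hlim) ?_
  refine ((g.continuous.tendsto x).comp hlim).congr fun n => ?_
  have e := congrArg (fun T : L2 (Ball s) →L[ℂ] L2 (Ball s) =>
    T (basisVec ⟨n, ⟨m n, hm n⟩⟩)) hfg
  change mulOp s f _ = mulOp s g _ at e
  rw [mulOp_basisVec, mulOp_basisVec] at e
  exact (smul_left_injective ℂ (orthonormal_basisVec.ne_zero _) e).symm

/-- The vector `s^{-1/2} ∑_{0 ≤ j < s} E_{(n+1, x + j sⁿ)}`, for `v = (n, x)`. -/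
def serreVec (s : ℕ) (v : Ball s) : L2 (Ball s) :=
  ((1 / Real.sqrt s : ℝ) : ℂ) • ∑ j : Fin s, basisVec (v.child j)

theorem orthonormal_serreVec (s : ℕ) [NeZero s] : Orthonormal ℂ (serreVec s) := by
  rw [orthonormal_iff_ite]
  intro v w
  have key : ∀ j k : Fin s, inner ℂ (basisVec (v.child j)) (basisVec (w.child k))
      = if v = w ∧ j = k then (1 : ℂ) else 0 := by
    intro j k
    rw [orthonormal_iff_ite.mp orthonormal_basisVec]
    congr 1
    refine propext ⟨Ball.child_injective, ?_⟩
    rintro ⟨rfl, rfl⟩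
    rfl
  simp only [serreVec, inner_smul_left, inner_smul_right, sum_inner, inner_sum, key]
  by_cases h : v = w
  · have hs : (s : ℝ) ≠ 0 := by exact_mod_cast NeZero.ne s
    have hsum : ∑ x : Fin s, ((1 / Real.sqrt s : ℝ) : ℂ)
        * ∑ y : Fin s, (if y = x then (1 : ℂ) else 0) = s • ((1 / Real.sqrt s : ℝ) : ℂ) := by
      simp
    simp only [h, true_and, if_true, Complex.conj_ofReal]
    rw [hsum, nsmul_eq_mul, ← Complex.ofReal_natCast, ← Complex.ofReal_mul,
      ← Complex.ofReal_mul]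
    rw [← Complex.ofReal_one]
    congr 1
    have := Real.mul_self_sqrt (Nat.cast_nonneg (α := ℝ) s)
    have h0 : Real.sqrt s ≠ 0 := by
      intro h0
      rw [h0] at this
      exact hs (by linarith)
    field_simp
    linarith [this]
  · simp [h]

/-- The Serre shift `W E_{(n,x)} = s^{-1/2} ∑_{0 ≤ j < s} E_{(n+1, x + j sⁿ)}` on `ℓ²(𝒱)`. -/
def serreShift (s : ℕ) [NeZero s] : L2 (Ball s) →L[ℂ] L2 (Ball s) :=
  (isometryOfOrthonormal (orthonormal_serreVec s)).toContinuousLinearMap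

theorem serreShift_basisVec (s : ℕ) [NeZero s] (v : Ball s) :
    serreShift s (basisVec v) = serreVec s v :=
  isometryOfOrthonormal_basisVec (orthonormal_serreVec s) v

theorem star_serreShift_mul_self (s : ℕ) [NeZero s] :
    star (serreShift s) * serreShift s = 1 :=
  (ContinuousLinearMap.norm_map_iff_adjoint_comp_self _).mp
    (isometryOfOrthonormal (orthonormal_serreVec s)).norm_map

/-- The Serre shift algebra `A_W = C*(W, M_f | f ∈ C(ℤ_s))`. -/
def serreAlgebra (s : ℕ) [NeZero s] : StarSubalgebra ℂ (L2 (Ball s) →L[ℂ] L2 (Ball s)) :=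
  (StarAlgebra.adjoin ℂ ({serreShift s} ∪ Set.range (mulRep s))).topologicalClosure

/-! ## The gauge action and the ideal `ℐ_W` -/

/-- The diagonal unitary `𝒰_θ E_{(n,x)} = e^{2πinθ} E_{(n,x)}`. -/
def gaugeUnitary (s : ℕ) (θ : ℝ) : L2 (Ball s) →L[ℂ] L2 (Ball s) :=
  diagOp (fun v => Complex.exp ((2 * Real.pi * v.1 * θ : ℝ) * Complex.I)) zero_le_one
    (fun _ => (Complex.norm_exp_ofReal_mul_I _).le)

theorem gaugeUnitary_basisVec (s : ℕ) (θ : ℝ) (v : Ball s) :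
    gaugeUnitary s θ (basisVec v)
      = Complex.exp ((2 * Real.pi * v.1 * θ : ℝ) * Complex.I) • basisVec v :=
  diagOp_basisVec (fun v : Ball s => Complex.exp ((2 * Real.pi * v.1 * θ : ℝ) * Complex.I))
    zero_le_one (fun _ => (Complex.norm_exp_ofReal_mul_I _).le) v

theorem gaugeUnitary_mul_neg (s : ℕ) (θ : ℝ) :
    gaugeUnitary s θ * gaugeUnitary s (-θ) = 1 := by
  refine ext_basisVec fun v => ?_
  change gaugeUnitary s θ (gaugeUnitary s (-θ) (basisVec v)) = basisVec v
  rw [gaugeUnitary_basisVec, map_smul, gaugeUnitary_basisVec,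
    smul_smul, ← Complex.exp_add, ← add_mul, ← Complex.ofReal_add]
  simp

/-- The gauge action `ρ_θ(a) = 𝒰_θ a 𝒰_θ⁻¹`; here `𝒰_θ⁻¹ = 𝒰_{-θ}`. -/
def gaugeAction (s : ℕ) (θ : ℝ) (a : L2 (Ball s) →L[ℂ] L2 (Ball s)) :
    L2 (Ball s) →L[ℂ] L2 (Ball s) :=
  gaugeUnitary s θ * a * gaugeUnitary s (-θ)

/-- The set `I_W = 𝒦(H)_inv` of gauge invariant compact operators. -/
def invCompact (s : ℕ) : Set (L2 (Ball s) →L[ℂ] L2 (Ball s)) :=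
  {a | IsCompactOperator a ∧ ∀ θ : ℝ, gaugeAction s θ a = a}

/-- The `C*`-algebra `ℐ_W = C*(a Wⁿ | a ∈ I_W, n = 0, 1, …)` (generated as a `C*`-algebra that
need not contain the identity operator). -/
def serreIdealAlgebra (s : ℕ) [NeZero s] :
    NonUnitalStarSubalgebra ℂ (L2 (Ball s) →L[ℂ] L2 (Ball s)) :=
  (NonUnitalStarAlgebra.adjoin ℂ
    {T | ∃ a ∈ invCompact s, ∃ n : ℕ, T = a * serreShift s ^ n}).topologicalClosure

/-! ### `ℐ_W` is an ideal of `A_W` -/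

section GaugeInvariance

variable {s : ℕ}

theorem star_gaugeUnitary (θ : ℝ) : star (gaugeUnitary s θ) = gaugeUnitary s (-θ) := by
  refine star_diagOp _ _ _ _ _ _ fun v => ?_
  rw [Complex.star_def, ← Complex.exp_conj, map_mul, Complex.conj_ofReal, Complex.conj_I]
  congr 1
  push_cast
  ring

theorem gaugeAction_mul (θ : ℝ) (a b : L2 (Ball s) →L[ℂ] L2 (Ball s)) :
    gaugeAction s θ (a * b) = gaugeAction s θ a * gaugeAction s θ b := by
  have h : gaugeUnitary s (-θ) * gaugeUnitary s θ = 1 := by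
    simpa using gaugeUnitary_mul_neg s (-θ)
  calc gaugeUnitary s θ * (a * b) * gaugeUnitary s (-θ)
      = gaugeUnitary s θ * a * 1 * (b * gaugeUnitary s (-θ)) := by simp only [mul_assoc, one_mul]
    _ = gaugeUnitary s θ * a * (gaugeUnitary s (-θ) * gaugeUnitary s θ)
          * (b * gaugeUnitary s (-θ)) := by rw [h]
    _ = _ := by simp only [gaugeAction, mul_assoc]

theorem gaugeAction_star (θ : ℝ) (a : L2 (Ball s) →L[ℂ] L2 (Ball s)) :
    gaugeAction s θ (star a) = star (gaugeAction s θ a) := by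
  simp only [gaugeAction, star_mul, star_gaugeUnitary, neg_neg, mul_assoc]

theorem gaugeAction_mulRep [NeZero s] (θ : ℝ) (f : C(SAdic s, ℂ)) :
    gaugeAction s θ (mulRep s f) = mulRep s f := by
  refine ext_basisVec fun v => ?_
  change gaugeUnitary s θ (mulOp s f (gaugeUnitary s (-θ) (basisVec v))) = mulOp s f (basisVec v)
  rw [gaugeUnitary_basisVec, map_smul, mulOp_basisVec, map_smul, map_smul, gaugeUnitary_basisVec,
    smul_smul, smul_smul, mul_right_comm, ← Complex.exp_add, ← add_mul, ← Complex.ofReal_add]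
  simp

theorem gaugeAction_serreShift [NeZero s] (θ : ℝ) :
    gaugeAction s θ (serreShift s)
      = Complex.exp ((2 * Real.pi * θ : ℝ) * Complex.I) • serreShift s := by
  refine ext_basisVec fun v => ?_
  change gaugeUnitary s θ (serreShift s (gaugeUnitary s (-θ) (basisVec v)))
    = Complex.exp ((2 * Real.pi * θ : ℝ) * Complex.I) • serreShift s (basisVec v)
  have h : gaugeUnitary s θ (serreVec s v)
      = Complex.exp ((2 * Real.pi * (v.1 + 1 : ℕ) * θ : ℝ) * Complex.I) • serreVec s v := by
    simp only [serreVec, map_smul, map_sum, gaugeUnitary_basisVec, Ball.child]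
    rw [← Finset.smul_sum, smul_comm]
  rw [gaugeUnitary_basisVec, map_smul, serreShift_basisVec, map_smul, h, smul_smul,
    ← Complex.exp_add, ← add_mul, ← Complex.ofReal_add]
  congr 4
  push_cast
  ring

/-- Conjugation by the Serre shift preserves gauge invariance. -/
theorem gaugeAction_conj [NeZero s] {a : L2 (Ball s) →L[ℂ] L2 (Ball s)}
    (ha : ∀ θ, gaugeAction s θ a = a) (θ : ℝ) :
    gaugeAction s θ (serreShift s * a * star (serreShift s))
        = serreShift s * a * star (serreShift s) ∧
      gaugeAction s θ (star (serreShift s) * a * serreShift s)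
        = star (serreShift s) * a * serreShift s := by
  have h : star (Complex.exp ((2 * Real.pi * θ : ℝ) * Complex.I))
      * Complex.exp ((2 * Real.pi * θ : ℝ) * Complex.I) = 1 := by
    rw [Complex.star_def, ← Complex.normSq_eq_conj_mul_self, Complex.normSq_eq_norm_sq,
      Complex.norm_exp_ofReal_mul_I]
    simp
  simp only [gaugeAction_mul, gaugeAction_star, gaugeAction_serreShift, ha, star_smul,
    smul_mul_assoc, mul_smul_comm, smul_smul]
  rw [h, mul_comm, h, one_smul, one_smul]
  exact ⟨rfl, rfl⟩

theorem gaugeAction_conj_pow [NeZero s] {a : L2 (Ball s) →L[ℂ] L2 (Ball s)}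
    (ha : ∀ θ, gaugeAction s θ a = a) (n : ℕ) (θ : ℝ) :
    gaugeAction s θ (serreShift s ^ n * a * star (serreShift s) ^ n)
        = serreShift s ^ n * a * star (serreShift s) ^ n := by
  induction n generalizing θ with
  | zero => simpa using ha θ
  | succ n ih =>
    have := (gaugeAction_conj ih θ).1
    rw [pow_succ', pow_succ]
    simpa only [mul_assoc] using this

theorem isCompactOperator_star {a : L2 (Ball s) →L[ℂ] L2 (Ball s)} (ha : IsCompactOperator a) :
    IsCompactOperator (star a : L2 (Ball s) →L[ℂ] L2 (Ball s)) := by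
  have h1 : IsCompactOperator (a * star a : L2 (Ball s) →L[ℂ] L2 (Ball s)) := ha.comp_clm (star a)
  refine (isCompactOperator_iff_isCompact_closure_image_closedBall
    ((star a : L2 (Ball s) →L[ℂ] L2 (Ball s)) : L2 (Ball s) →ₗ[ℂ] L2 (Ball s)) one_pos).mpr ?_
  have h2 := ((isCompactOperator_iff_isCompact_closure_image_closedBall
    ((a * star a : L2 (Ball s) →L[ℂ] L2 (Ball s)) : L2 (Ball s) →ₗ[ℂ] L2 (Ball s))
    one_pos).mp h1).totallyBounded.subset subset_closure
  refine TotallyBounded.isCompact_of_isClosed (TotallyBounded.closure ?_) isClosed_closure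
  refine Metric.totallyBounded_iff.mpr fun ε hε => ?_
  obtain ⟨t, ht, hfin, hcov⟩ := Metric.finite_approx_of_totallyBounded h2 (ε ^ 2 / 2) (by positivity)
  have ht' : ∀ y ∈ t, ∃ x : L2 (Ball s), x ∈ Metric.closedBall (0 : L2 (Ball s)) 1 ∧
      (a * star a : L2 (Ball s) →L[ℂ] L2 (Ball s)) x = y := fun y hy => ht hy
  choose! g hg using ht'
  refine ⟨(fun y => star a (g y)) '' t, hfin.image _, ?_⟩
  rintro _ ⟨x, hx, rfl⟩
  obtain ⟨y, hy, hxy⟩ := Set.mem_iUnion₂.mp (hcov ⟨x, hx, rfl⟩)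
  refine Set.mem_iUnion₂.mpr ⟨_, ⟨y, hy, rfl⟩, ?_⟩
  obtain ⟨hgy, hgy'⟩ := hg y hy
  rw [Metric.mem_ball, dist_eq_norm] at hxy ⊢
  change ‖star a x - star a (g y)‖ < ε
  change ‖a (star a x) - y‖ < _ at hxy
  rw [← hgy'] at hxy
  change ‖a (star a x) - a (star a (g y))‖ < _ at hxy
  rw [← map_sub, ← map_sub] at hxy
  rw [← map_sub]
  have hb : ‖x - g y‖ ≤ 2 := by
    have e1 : ‖x‖ ≤ 1 := by simpa using hx
    have e2 : ‖g y‖ ≤ 1 := by simpa using hgy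
    linarith [norm_sub_le x (g y)]
  have hsq : ‖star a (x - g y)‖ ^ 2 ≤ ‖x - g y‖ * ‖a (star a (x - g y))‖ := by
    have e : inner ℂ (x - g y) (a (star a (x - g y)))
        = ((‖star a (x - g y)‖ : ℂ)) ^ 2 := by
      rw [ContinuousLinearMap.star_eq_adjoint, ← ContinuousLinearMap.adjoint_inner_left,
        inner_self_eq_norm_sq_to_K]
      rfl
    have := norm_inner_le_norm (𝕜 := ℂ) (x - g y) (a (star a (x - g y)))
    rw [e] at this
    simpa using this
  have hlt : ‖star a (x - g y)‖ ^ 2 < ε ^ 2 := by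
    nlinarith [norm_nonneg (a (star a (x - g y))), norm_nonneg (x - g y)]
  exact lt_of_pow_lt_pow_left₀ 2 hε.le hlt

theorem star_mem_invCompact {a : L2 (Ball s) →L[ℂ] L2 (Ball s)} (ha : a ∈ invCompact s) :
    star a ∈ invCompact s :=
  ⟨isCompactOperator_star ha.1, fun θ => by rw [gaugeAction_star, ha.2]⟩

theorem mul_mem_invCompact {a b : L2 (Ball s) →L[ℂ] L2 (Ball s)} (ha : a ∈ invCompact s)
    (hb : ∀ θ, gaugeAction s θ b = b) : a * b ∈ invCompact s ∧ b * a ∈ invCompact s :=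
  ⟨⟨ha.1.comp_clm b, fun θ => by rw [gaugeAction_mul, ha.2, hb]⟩,
    ⟨ha.1.clm_comp b, fun θ => by rw [gaugeAction_mul, ha.2, hb]⟩⟩

theorem conj_mem_invCompact [NeZero s] {a : L2 (Ball s) →L[ℂ] L2 (Ball s)}
    (ha : a ∈ invCompact s) :
    serreShift s * a * star (serreShift s) ∈ invCompact s ∧
      star (serreShift s) * a * serreShift s ∈ invCompact s :=
  ⟨⟨(ha.1.clm_comp (serreShift s)).comp_clm (star (serreShift s)),
      fun θ => (gaugeAction_conj ha.2 θ).1⟩,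
    ⟨(ha.1.clm_comp (star (serreShift s))).comp_clm (serreShift s), fun θ => (gaugeAction_conj ha.2 θ).2⟩⟩

theorem mul_pow_mem_serreIdealAlgebra [NeZero s] {a : L2 (Ball s) →L[ℂ] L2 (Ball s)}
    (ha : a ∈ invCompact s) (n : ℕ) : a * serreShift s ^ n ∈ serreIdealAlgebra s :=
  subset_closure (NonUnitalStarAlgebra.subset_adjoin ℂ _ ⟨a, ha, n, rfl⟩)

theorem pow_mul_mem_serreIdealAlgebra [NeZero s] {a : L2 (Ball s) →L[ℂ] L2 (Ball s)}
    (ha : a ∈ invCompact s) (n : ℕ) : star (serreShift s) ^ n * a ∈ serreIdealAlgebra s := by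
  have := star_mem (mul_pow_mem_serreIdealAlgebra (star_mem_invCompact ha) n)
  simpa using this

theorem star_pow_mul_pow [NeZero s] (n : ℕ) : star (serreShift s) ^ n * serreShift s ^ n = 1 := by
  induction n with
  | zero => simp
  | succ n ih =>
    rw [pow_succ, pow_succ', mul_assoc, ← mul_assoc (star (serreShift s)),
      star_serreShift_mul_self, one_mul, ih]

/-- To prove that left multiplication by `b` preserves `ℐ_W`, it suffices to look at the
generators of `ℐ_W` and their adjoints. -/
theorem mul_mem_serreIdealAlgebra_of_generators [NeZero s] {b : L2 (Ball s) →L[ℂ] L2 (Ball s)}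
    (h1 : ∀ a ∈ invCompact s, ∀ n : ℕ, b * (a * serreShift s ^ n) ∈ serreIdealAlgebra s)
    (h2 : ∀ a ∈ invCompact s, ∀ n : ℕ, b * (star (serreShift s) ^ n * a) ∈ serreIdealAlgebra s)
    {x : L2 (Ball s) →L[ℂ] L2 (Ball s)} (hx : x ∈ serreIdealAlgebra s) :
    b * x ∈ serreIdealAlgebra s := by
  have hcl : IsClosed {y | b * y ∈ serreIdealAlgebra s} :=
    (NonUnitalStarSubalgebra.isClosed_topologicalClosure _).preimage (continuous_const_mul b)
  refine closure_minimal (fun y hy => ?_) hcl hx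
  change y ∈ NonUnitalAlgebra.adjoin ℂ _ at hy
  change b * y ∈ serreIdealAlgebra s
  induction hy using NonUnitalAlgebra.adjoin_induction with
  | mem y hy =>
    rcases hy with ⟨a, ha, n, rfl⟩ | hy
    · exact h1 a ha n
    · obtain ⟨a, ha, n, h⟩ := Set.mem_star.mp hy
      rw [← star_star y, h, star_mul, star_pow]
      exact h2 _ (star_mem_invCompact ha) n
  | add y z _ _ hy hz => rw [mul_add]; exact add_mem hy hz
  | zero => rw [mul_zero]; exact zero_mem _
  | mul y z _ hz' hy hz =>
    rw [← mul_assoc]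
    exact mul_mem hy (subset_closure hz')
  | smul c y _ hy => rw [mul_smul_comm]; exact SMulMemClass.smul_mem c hy

/-- Left multiplication by a gauge invariant operator preserves `ℐ_W`. -/
theorem invariant_mul_mem [NeZero s] {b : L2 (Ball s) →L[ℂ] L2 (Ball s)}
    (hb : ∀ θ, gaugeAction s θ b = b) {x : L2 (Ball s) →L[ℂ] L2 (Ball s)}
    (hx : x ∈ serreIdealAlgebra s) : b * x ∈ serreIdealAlgebra s := by
  refine mul_mem_serreIdealAlgebra_of_generators (fun a ha n => ?_) (fun a ha n => ?_) hx
  · rw [← mul_assoc]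
    exact mul_pow_mem_serreIdealAlgebra (mul_mem_invCompact ha hb).2 n
  · have h := pow_mul_mem_serreIdealAlgebra
      (mul_mem_invCompact ha (gaugeAction_conj_pow hb n)).2 n
    rwa [← mul_assoc, ← mul_assoc, ← mul_assoc, star_pow_mul_pow, one_mul, mul_assoc] at h

theorem shift_mul_mem [NeZero s] {x : L2 (Ball s) →L[ℂ] L2 (Ball s)}
    (hx : x ∈ serreIdealAlgebra s) : serreShift s * x ∈ serreIdealAlgebra s := by
  have key : ∀ a ∈ invCompact s, ∀ n : ℕ,
      serreShift s * (a * serreShift s ^ n) ∈ serreIdealAlgebra s := by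
    intro a ha n
    have h := mul_pow_mem_serreIdealAlgebra (conj_mem_invCompact ha).1 (n + 1)
    have e : serreShift s * a * star (serreShift s) * serreShift s ^ (n + 1)
        = serreShift s * (a * serreShift s ^ n) := by
      rw [pow_succ', mul_assoc, ← mul_assoc (star (serreShift s)), star_serreShift_mul_self,
        one_mul, mul_assoc]
    rwa [e] at h
  refine mul_mem_serreIdealAlgebra_of_generators key (fun a ha n => ?_) hx
  cases n with
  | zero => simpa using key a ha 0
  | succ n =>
    rw [pow_succ', mul_assoc, ← mul_assoc]
    refine invariant_mul_mem (fun θ => ?_) (pow_mul_mem_serreIdealAlgebra ha n)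
    simpa using gaugeAction_conj_pow (s := s) (a := 1)
      (fun θ => by rw [gaugeAction, mul_one, gaugeUnitary_mul_neg]) 1 θ

theorem star_shift_mul_mem [NeZero s] {x : L2 (Ball s) →L[ℂ] L2 (Ball s)}
    (hx : x ∈ serreIdealAlgebra s) : star (serreShift s) * x ∈ serreIdealAlgebra s := by
  have key : ∀ a ∈ invCompact s, ∀ n : ℕ,
      star (serreShift s) * (star (serreShift s) ^ n * a) ∈ serreIdealAlgebra s := by
    intro a ha n
    rw [← mul_assoc, ← pow_succ']
    exact pow_mul_mem_serreIdealAlgebra ha (n + 1)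
  refine mul_mem_serreIdealAlgebra_of_generators (fun a ha n => ?_) key hx
  cases n with
  | zero => simpa using key a ha 0
  | succ n =>
    have h := mul_pow_mem_serreIdealAlgebra (conj_mem_invCompact ha).2 n
    rwa [mul_assoc, ← pow_succ', mul_assoc] at h

theorem serreAlgebra_mul_mem [NeZero s] {b x : L2 (Ball s) →L[ℂ] L2 (Ball s)}
    (hb : b ∈ serreAlgebra s) (hx : x ∈ serreIdealAlgebra s) : b * x ∈ serreIdealAlgebra s := by
  suffices hsub : ∀ c ∈ Algebra.adjoin ℂ
      (({serreShift s} ∪ Set.range (mulRep s)) ∪ star ({serreShift s} ∪ Set.range (mulRep s))),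
      ∀ x ∈ serreIdealAlgebra s, c * x ∈ serreIdealAlgebra s from
    closure_minimal (fun c hc => hsub c hc x hx)
      ((NonUnitalStarSubalgebra.isClosed_topologicalClosure _).preimage
        (continuous_mul_const x)) hb
  clear hx hb x b
  intro c hc
  induction hc using Algebra.adjoin_induction with
  | mem c hc =>
    intro x hx
    rcases hc with (hc | ⟨f, rfl⟩) | hc
    · rw [Set.mem_singleton_iff.mp hc]
      exact shift_mul_mem hx
    · exact invariant_mul_mem (fun θ => gaugeAction_mulRep θ f) hx
    · rcases Set.mem_star.mp hc with hc | ⟨f, hf⟩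
      · rw [← star_star c, Set.mem_singleton_iff.mp hc]
        exact star_shift_mul_mem hx
      · rw [← star_star c, ← hf]
        exact invariant_mul_mem (fun θ => by rw [gaugeAction_star, gaugeAction_mulRep]) hx
  | algebraMap r =>
    intro x hx
    rw [Algebra.algebraMap_eq_smul_one, smul_mul_assoc, one_mul]
    exact SMulMemClass.smul_mem r hx
  | add c d _ _ hc hd =>
    intro x hx
    rw [add_mul]
    exact add_mem (hc x hx) (hd x hx)
  | mul c d _ _ hc hd =>
    intro x hx
    rw [mul_assoc]
    exact hc _ (hd x hx)

end GaugeInvariance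

/-- The ideal `ℐ_W`, as an ideal of the `C*`-algebra `A_W`. -/
def serreIdeal (s : ℕ) [NeZero s] : Ideal (serreAlgebra s) where
  carrier := {a | (a : L2 (Ball s) →L[ℂ] L2 (Ball s)) ∈ serreIdealAlgebra s}
  add_mem' ha hb := (serreIdealAlgebra s).add_mem ha hb
  zero_mem' := zero_mem (serreIdealAlgebra s)
  smul_mem' b _ hx := serreAlgebra_mul_mem b.2 hx

instance serreIdeal_isStarIdeal (s : ℕ) [NeZero s] : IsStarIdeal (serreIdeal s) where
  star_mem ha := (serreIdealAlgebra s).star_mem' ha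

instance serreIdeal_isTwoSided (s : ℕ) [NeZero s] : (serreIdeal s).IsTwoSided where
  mul_mem_of_left {a} b ha := by
    have h : star (star b * star a) ∈ serreIdeal s :=
      IsStarIdeal.star_mem ((serreIdeal s).mul_mem_left (star b) (IsStarIdeal.star_mem ha))
    simpa using h

end

/-! Write `P_N` for `levelProj s N`, `S` for the unilateral shift and `H` for `ℓ²(𝒱)`. The Serre
shift raises the level by one, and a function of the first `N` digits is constant on the children of
a ball of level at least `N`. Hence, for locally constant `f`, `W` and `M_f` commute beyond some
level. This suggests a symbol map `σ` with `W ↦ S ⊗ 1` and `M_f ↦ 1 ⊗ M_f`. The theorem reduces to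
the identity `‖σ(a)‖ = inf ‖a + c‖`, with `c` running over the ideal. Besides being a closed ideal,
`ℐ_W` enters only through two facts: its elements are compact, and it contains every `1 - P_N`.

Lower bound (`norm_snd_le_norm_fst_add`): differences of two children of a ball lie in the kernel of
`W*`. Such wandering vectors and their translates by powers of `W` give isometries `V_n : ℓ²(ℕ) ⊗ H
→ H` with range in the levels at least `n`. On the `*`-algebra of the generators `a V_n = V_n σ(a)`
for large `n`, while `‖c V_n‖ → 0` for compact `c`.

Upper bound (`exists_norm_fst_add_le`): on the range of `P_N` the shift is a pure isometry. Its Wold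
decomposition is a map `H → ℓ²(ℕ) ⊗ H` of norm `‖P_N ξ‖` at `ξ` that intertwines `a + c` with
`σ(a)`, for some `c` in the ideal. So `‖P_N (a + c)‖ ≤ ‖σ(a)‖`, and `P_N (a + c)` differs from `a`
by an element of the ideal.

The map `σ` is obtained from its graph, the closed `*`-algebra generated by `(W, S ⊗ 1)` and the
`(M_f, 1 ⊗ M_f)`. The lower bound with `c = 0` makes it single valued and its first projection
isometric, so its domain is closed and contains `A_W`. A dense range and the norm identity give the
isomorphism.

That `ℐ_W` lies in `A_W` holds because `A_W` contains all compact operators: a commutator of `W`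
with a digit function has rank one, and it yields all matrix units. -/

noncomputable section

/-! ### Operators on Hilbert space tensor products -/

section OpTensor

variable {H K : Type*} [NormedAddCommGroup H] [InnerProductSpace ℂ H]
  [NormedAddCommGroup K] [InnerProductSpace ℂ K]

/-- The elementary tensor as a bilinear map into the Hilbert space tensor product. -/
def HilbertTensor.mk : H →ₗ[ℂ] K →ₗ[ℂ] HilbertTensor H K :=
  (TensorProduct.mk ℂ H K).compr₂
    (UniformSpace.Completion.toComplₗᵢ (𝕜 := ℂ) (E := H ⊗[ℂ] K)).toLinearMap

theorem HilbertTensor.mk_apply (x : H) (y : K) : HilbertTensor.mk x y = HilbertTensor.tmul x y :=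
  rfl

theorem HilbertTensor.inner_tmul (x x' : H) (y y' : K) :
    inner ℂ (HilbertTensor.tmul x y) (HilbertTensor.tmul x' y') = inner ℂ x x' * inner ℂ y y' :=
  (UniformSpace.Completion.inner_coe _ _).trans (TensorProduct.inner_tmul ..)

theorem HilbertTensor.norm_tmul (x : H) (y : K) : ‖HilbertTensor.tmul x y‖ = ‖x‖ * ‖y‖ :=
  (UniformSpace.Completion.norm_coe _).trans (TensorProduct.norm_tmul x y)

theorem HilbertTensor.dense_span_tmul :
    Dense (Submodule.span ℂ (Set.range fun p : H × K => HilbertTensor.tmul p.1 p.2) :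
      Set (HilbertTensor H K)) := by
  refine Dense.mono ?_ (UniformSpace.Completion.denseRange_coe (α := H ⊗[ℂ] K))
  rintro _ ⟨z, rfl⟩
  induction z using TensorProduct.induction_on with
  | zero => exact Submodule.zero_mem _
  | tmul x y => exact Submodule.subset_span ⟨(x, y), rfl⟩
  | add z w hz hw =>
    rw [UniformSpace.Completion.coe_add]
    exact Submodule.add_mem _ hz hw

/-- Two bounded operators that agree on elementary tensors are equal. -/
theorem HilbertTensor.ext_tmul {E : Type*} [NormedAddCommGroup E] [NormedSpace ℂ E]
    {a b : HilbertTensor H K →L[ℂ] E}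
    (h : ∀ x y, a (HilbertTensor.tmul x y) = b (HilbertTensor.tmul x y)) : a = b :=
  ContinuousLinearMap.ext_on HilbertTensor.dense_span_tmul (by
    rintro _ ⟨p, rfl⟩
    exact h p.1 p.2)

variable [CompleteSpace H] [CompleteSpace K]

theorem opTensor_one : opTensor (1 : H →L[ℂ] H) (1 : K →L[ℂ] K) = 1 :=
  HilbertTensor.ext_tmul fun x y => by rw [opTensor_tmul]; rfl

theorem opTensor_mul (a a' : H →L[ℂ] H) (b b' : K →L[ℂ] K) :
    opTensor (a * a') (b * b') = opTensor a b * opTensor a' b' :=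
  HilbertTensor.ext_tmul fun x y => by
    change _ = opTensor a b (opTensor a' b' _)
    rw [opTensor_tmul, opTensor_tmul, opTensor_tmul]
    rfl

theorem opTensor_add_left (a a' : H →L[ℂ] H) (b : K →L[ℂ] K) :
    opTensor (a + a') b = opTensor a b + opTensor a' b :=
  HilbertTensor.ext_tmul fun x y => by
    rw [_root_.add_apply, opTensor_tmul, opTensor_tmul, opTensor_tmul]
    simp [← HilbertTensor.mk_apply]

theorem opTensor_add_right (a : H →L[ℂ] H) (b b' : K →L[ℂ] K) :
    opTensor a (b + b') = opTensor a b + opTensor a b' :=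
  HilbertTensor.ext_tmul fun x y => by
    rw [_root_.add_apply, opTensor_tmul, opTensor_tmul, opTensor_tmul]
    simp [← HilbertTensor.mk_apply]

theorem opTensor_smul_left (c : ℂ) (a : H →L[ℂ] H) (b : K →L[ℂ] K) :
    opTensor (c • a) b = c • opTensor a b :=
  HilbertTensor.ext_tmul fun x y => by
    rw [_root_.smul_apply, opTensor_tmul, opTensor_tmul]
    simp [← HilbertTensor.mk_apply]

theorem opTensor_smul_right (c : ℂ) (a : H →L[ℂ] H) (b : K →L[ℂ] K) :
    opTensor a (c • b) = c • opTensor a b :=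
  HilbertTensor.ext_tmul fun x y => by
    rw [_root_.smul_apply, opTensor_tmul, opTensor_tmul]
    simp [← HilbertTensor.mk_apply]

theorem norm_opTensor_le (a : H →L[ℂ] H) (b : K →L[ℂ] K) : ‖opTensor a b‖ ≤ ‖a‖ * ‖b‖ := by
  refine ContinuousLinearMap.opNorm_le_bound _ (by positivity) fun z => ?_
  refine UniformSpace.Completion.induction_on z
    (isClosed_le ((opTensor a b).continuous.norm) (continuous_const.mul continuous_norm)) fun w => ?_
  have h1 : opTensor a b (w : UniformSpace.Completion (H ⊗[ℂ] K))
      = ((opTensorAlg a b w : H ⊗[ℂ] K) : UniformSpace.Completion (H ⊗[ℂ] K)) :=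
    (opTensorAlg a b).completion_apply_coe w
  have h2 : ‖opTensorAlg a b w‖ ≤ ‖a‖ * ‖b‖ * ‖w‖ :=
    (opTensorAlg a b).le_of_opNorm_le (LinearMap.mkContinuous_norm_le _ (by positivity) _) w
  calc ‖opTensor a b (w : UniformSpace.Completion (H ⊗[ℂ] K))‖
      = ‖((opTensorAlg a b w : H ⊗[ℂ] K) : UniformSpace.Completion (H ⊗[ℂ] K))‖ := by rw [h1]; rfl
    _ = ‖opTensorAlg a b w‖ := UniformSpace.Completion.norm_coe _
    _ ≤ _ := h2
    _ = ‖a‖ * ‖b‖ * ‖(w : UniformSpace.Completion (H ⊗[ℂ] K))‖ := by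
      rw [UniformSpace.Completion.norm_coe]

theorem star_opTensor (a : H →L[ℂ] H) (b : K →L[ℂ] K) :
    star (opTensor a b) = opTensor (star a) (star b) := by
  refine HilbertTensor.ext_tmul fun x y => ?_
  refine HilbertTensor.dense_span_tmul.eq_of_inner_left (𝕜 := ℂ) fun v hv => ?_
  induction hv using Submodule.span_induction with
  | zero => simp
  | add v w _ _ hv hw => rw [inner_add_right, inner_add_right, hv, hw]
  | smul c v _ hv => rw [inner_smul_right, inner_smul_right, hv]
  | mem v hv =>
    obtain ⟨p, rfl⟩ := hv
    rw [ContinuousLinearMap.star_eq_adjoint, ContinuousLinearMap.adjoint_inner_left,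
      opTensor_tmul, opTensor_tmul, HilbertTensor.inner_tmul, HilbertTensor.inner_tmul,
      ContinuousLinearMap.star_eq_adjoint, ContinuousLinearMap.star_eq_adjoint,
      ContinuousLinearMap.adjoint_inner_left, ContinuousLinearMap.adjoint_inner_left]

/-- The amplification `a ↦ a ⊗ 1`. -/
def amplifyLeft : (H →L[ℂ] H) →⋆ₐ[ℂ] (HilbertTensor H K →L[ℂ] HilbertTensor H K) where
  toFun a := opTensor a 1
  map_one' := opTensor_one
  map_mul' a b := by rw [← opTensor_mul, one_mul]
  map_zero' := by simpa using opTensor_smul_left (0 : ℂ) (0 : H →L[ℂ] H) (1 : K →L[ℂ] K)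
  map_add' a b := opTensor_add_left a b 1
  commutes' c := by
    rw [Algebra.algebraMap_eq_smul_one, opTensor_smul_left, opTensor_one,
      Algebra.algebraMap_eq_smul_one]
  map_star' a := by rw [star_opTensor, star_one]

/-- The amplification `b ↦ 1 ⊗ b`. -/
def amplifyRight : (K →L[ℂ] K) →⋆ₐ[ℂ] (HilbertTensor H K →L[ℂ] HilbertTensor H K) where
  toFun b := opTensor 1 b
  map_one' := opTensor_one
  map_mul' a b := by rw [← opTensor_mul, one_mul]
  map_zero' := by simpa using opTensor_smul_right (0 : ℂ) (1 : H →L[ℂ] H) (0 : K →L[ℂ] K)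
  map_add' a b := opTensor_add_right 1 a b
  commutes' c := by
    rw [Algebra.algebraMap_eq_smul_one, opTensor_smul_right, opTensor_one,
      Algebra.algebraMap_eq_smul_one]
  map_star' a := by rw [star_opTensor, star_one]

theorem amplifyLeft_apply (a : H →L[ℂ] H) : amplifyLeft (K := K) a = opTensor a 1 := rfl

theorem amplifyRight_apply (b : K →L[ℂ] K) : amplifyRight (H := H) b = opTensor 1 b := rfl

theorem amplifyLeft_mul_amplifyRight (a : H →L[ℂ] H) (b : K →L[ℂ] K) :
    amplifyLeft a * amplifyRight b = opTensor a b := by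
  rw [amplifyLeft_apply, amplifyRight_apply, ← opTensor_mul, mul_one, one_mul]

theorem continuous_amplifyLeft : Continuous (amplifyLeft (H := H) (K := K)) :=
  AddMonoidHomClass.continuous_of_bound _ ‖(1 : K →L[ℂ] K)‖ fun a => by
    rw [mul_comm]; exact norm_opTensor_le a 1

theorem continuous_amplifyRight : Continuous (amplifyRight (H := H) (K := K)) :=
  AddMonoidHomClass.continuous_of_bound _ ‖(1 : H →L[ℂ] H)‖ fun b => norm_opTensor_le 1 b

/-- The isometric embedding `y ↦ x ⊗ y`, for a unit vector `x`. -/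
def tmulIsometry (x : H) (hx : ‖x‖ = 1) : K →ₗᵢ[ℂ] HilbertTensor H K where
  toLinearMap := HilbertTensor.mk x
  norm_map' y := by
    rw [HilbertTensor.mk_apply, HilbertTensor.norm_tmul, hx, one_mul]

omit [CompleteSpace H] [CompleteSpace K] in
theorem tmulIsometry_apply (x : H) (hx : ‖x‖ = 1) (y : K) :
    tmulIsometry x hx y = HilbertTensor.tmul x y := rfl

end OpTensor

/-! ### Canonical bases and isometries on `ℓ²(ι) ⊗ ℓ²(κ)` -/

section TensorBasis

variable {ι κ : Type*} [DecidableEq ι] [DecidableEq κ]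

theorem norm_basisVec (i : ι) : ‖(basisVec i : L2 ι)‖ = 1 :=
  orthonormal_basisVec.1 i

theorem single_eq_smul_basisVec (i : ι) (c : ℂ) :
    (lp.single 2 i c : L2 ι) = c • (basisVec i : L2 ι) := by
  rw [basisVec, ← lp.single_smul, smul_eq_mul, mul_one]

theorem hasSum_basisVec (ξ : L2 ι) : HasSum (fun i => ξ i • (basisVec i : L2 ι)) ξ := by
  simpa only [single_eq_smul_basisVec] using lp.hasSum_single (p := 2) (by simp) ξ

theorem dense_span_basisVec :
    Dense (Submodule.span ℂ (Set.range (basisVec : ι → L2 ι)) : Set (L2 ι)) := by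
  intro ξ
  refine mem_closure_of_tendsto (hasSum_basisVec ξ) (Filter.Eventually.of_forall fun t => ?_)
  exact Submodule.sum_mem _ fun i _ =>
    Submodule.smul_mem _ _ (Submodule.subset_span (Set.mem_range_self i))

theorem clm_ext_basisVec {E : Type*} [NormedAddCommGroup E] [NormedSpace ℂ E]
    {a b : L2 ι →L[ℂ] E} (h : ∀ i, a (basisVec i) = b (basisVec i)) : a = b :=
  ContinuousLinearMap.ext_on dense_span_basisVec (by
    rintro _ ⟨i, rfl⟩
    exact h i)

theorem orthonormal_tmul_basisVec :
    Orthonormal ℂ fun p : ι × κ =>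
      HilbertTensor.tmul (basisVec p.1 : L2 ι) (basisVec p.2 : L2 κ) := by
  rw [orthonormal_iff_ite]
  intro p q
  rw [HilbertTensor.inner_tmul, orthonormal_iff_ite.mp orthonormal_basisVec,
    orthonormal_iff_ite.mp orthonormal_basisVec]
  by_cases h1 : p.1 = q.1 <;> by_cases h2 : p.2 = q.2 <;> simp [h1, h2, Prod.ext_iff]

/-- Density of the span of the basis is used in one variable at a time, with the other variable
frozen. -/
theorem HilbertTensor.ext_tmul_basisVec {E : Type*} [NormedAddCommGroup E] [NormedSpace ℂ E]
    {a b : HilbertTensor (L2 ι) (L2 κ) →L[ℂ] E}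
    (h : ∀ i j, a (HilbertTensor.tmul (basisVec i) (basisVec j))
      = b (HilbertTensor.tmul (basisVec i) (basisVec j))) : a = b := by
  have h1 : ∀ i y, a (HilbertTensor.tmul (basisVec i) y) = b (HilbertTensor.tmul (basisVec i) y) :=
    fun i y => congrArg (fun T : L2 κ →L[ℂ] E => T y) (clm_ext_basisVec
      (a := a.comp (tmulIsometry (basisVec i : L2 ι) (norm_basisVec i)).toContinuousLinearMap)
      (b := b.comp (tmulIsometry (basisVec i : L2 ι) (norm_basisVec i)).toContinuousLinearMap)
      (h i))
  refine HilbertTensor.ext_tmul fun x y => ?_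
  let L : L2 ι →L[ℂ] HilbertTensor (L2 ι) (L2 κ) :=
    (HilbertTensor.mk.flip y).mkContinuous ‖y‖ fun x => by
      rw [LinearMap.flip_apply, HilbertTensor.mk_apply, HilbertTensor.norm_tmul, mul_comm]
  exact congrArg (fun T : L2 ι →L[ℂ] E => T x) (clm_ext_basisVec (a := a.comp L) (b := b.comp L)
    fun i => h1 i y)

/-- The Hilbert basis of the elementary tensors of canonical basis vectors. -/
def tensorHilbertBasis (ι κ : Type*) [DecidableEq ι] [DecidableEq κ] :
    HilbertBasis (ι × κ) ℂ (HilbertTensor (L2 ι) (L2 κ)) :=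
  HilbertBasis.mkOfOrthogonalEqBot orthonormal_tmul_basisVec (by
    rw [Submodule.eq_bot_iff]
    intro z hz
    -- A vector orthogonal to the family defines a functional that vanishes on the basis tensors;
    -- the functional is zero, in particular at `z` itself.
    have h : innerSL ℂ z = 0 := HilbertTensor.ext_tmul_basisVec fun i j => by
      simpa using Submodule.inner_left_of_mem_orthogonal
        (Submodule.subset_span (Set.mem_range_self (i, j))) hz
    have := congrArg (fun T : HilbertTensor (L2 ι) (L2 κ) →L[ℂ] ℂ => T z) h
    simpa using this)

/-- The isometry that sends `E_i ⊗ E_j` to `w (i, j)`, for an orthonormal family `w`. -/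
def tensorIsometry {E : Type*} [NormedAddCommGroup E] [InnerProductSpace ℂ E] [CompleteSpace E]
    {w : ι × κ → E} (hw : Orthonormal ℂ w) : HilbertTensor (L2 ι) (L2 κ) →ₗᵢ[ℂ] E :=
  hw.orthogonalFamily.linearIsometry.comp
    (tensorHilbertBasis ι κ).repr.toLinearIsometry

theorem tensorIsometry_tmul {E : Type*} [NormedAddCommGroup E] [InnerProductSpace ℂ E]
    [CompleteSpace E] {w : ι × κ → E} (hw : Orthonormal ℂ w) (i : ι) (j : κ) :
    tensorIsometry hw (HilbertTensor.tmul (basisVec i) (basisVec j)) = w (i, j) := by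
  have h1 : HilbertTensor.tmul (basisVec i : L2 ι) (basisVec j : L2 κ)
      = tensorHilbertBasis ι κ (i, j) := by
    simp [tensorHilbertBasis]
  change hw.orthogonalFamily.linearIsometry ((tensorHilbertBasis ι κ).repr _) = _
  rw [h1, HilbertBasis.repr_self]
  simp [OrthogonalFamily.linearIsometry_apply_single]

end TensorBasis

/-! ### Rank one operators -/

section RankOne

variable {H K : Type*} [NormedAddCommGroup H] [InnerProductSpace ℂ H]
  [NormedAddCommGroup K] [InnerProductSpace ℂ K]

theorem isCompactOperator_rankOne (x : H) (y : K) :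
    IsCompactOperator (InnerProductSpace.rankOne ℂ x y : K →L[ℂ] H) := by
  have h : IsCompactOperator (id : ℂ → ℂ) := isCompactOperator_id
  exact (h.clm_comp (ContinuousLinearMap.toSpanSingleton ℂ x)).comp_clm (innerSL ℂ y)

end RankOne

/-! ### Level projections and compact operators -/

section LevelProjection

/-- The projection of `ℓ²(𝒱)` onto the span of the `E_{(n,x)}` with `n ≥ N`. -/
def levelProj (s N : ℕ) : L2 (Ball s) →L[ℂ] L2 (Ball s) :=
  diagOp (fun v => if N ≤ v.1 then 1 else 0) zero_le_one (fun v => by split_ifs <;> simp)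

variable {s : ℕ}

theorem levelProj_basisVec (N : ℕ) (v : Ball s) :
    levelProj s N (basisVec v) = if N ≤ v.1 then basisVec v else 0 := by
  rw [levelProj, diagOp_basisVec]
  split_ifs <;> simp

theorem star_levelProj (N : ℕ) : star (levelProj s N) = levelProj s N :=
  star_diagOp _ _ _ _ _ _ fun v => by split_ifs <;> simp

theorem levelProj_mul (M N : ℕ) : levelProj s M * levelProj s N = levelProj s (max M N) := by
  refine ext_basisVec fun v => ?_
  change levelProj s M (levelProj s N (basisVec v)) = _
  rw [levelProj_basisVec, levelProj_basisVec]
  by_cases h1 : N ≤ v.1 <;> by_cases h2 : M ≤ v.1 <;> simp [levelProj_basisVec, h1, h2]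

theorem levelProj_mul_self (N : ℕ) : levelProj s N * levelProj s N = levelProj s N := by
  rw [levelProj_mul, max_self]

theorem levelProj_zero : levelProj s 0 = 1 :=
  ext_basisVec fun v => by simp [levelProj_basisVec]

theorem norm_levelProj_le (N : ℕ) : ‖levelProj s N‖ ≤ 1 := by
  -- For a projection the `C*`-identity reads `‖P‖ = ‖P‖ * ‖P‖`.
  have h := CStarRing.norm_star_mul_self (x := levelProj s N)
  rw [star_levelProj, levelProj_mul_self] at h
  by_contra! h1
  nlinarith

theorem norm_levelProj_apply_le (N : ℕ) (ξ : L2 (Ball s)) : ‖levelProj s N ξ‖ ≤ ‖ξ‖ := by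
  simpa using (levelProj s N).le_of_opNorm_le (norm_levelProj_le N) ξ

/-- Finitely supported vectors are eventually annihilated, and contractivity carries the limit over
to their closure. -/
theorem tendsto_levelProj (ξ : L2 (Ball s)) :
    Filter.Tendsto (fun N => levelProj s N ξ) Filter.atTop (nhds 0) := by
  have hspan : ∀ η ∈ Submodule.span ℂ (Set.range (basisVec : Ball s → L2 (Ball s))),
      ∀ᶠ N in Filter.atTop, levelProj s N η = 0 := by
    intro η hη
    induction hη using Submodule.span_induction with
    | zero => simp
    | add η ζ _ _ h1 h2 =>
      filter_upwards [h1, h2] with N h1 h2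
      rw [map_add, h1, h2, add_zero]
    | smul c η _ h =>
      filter_upwards [h] with N h
      rw [map_smul, h, smul_zero]
    | mem η hη =>
      obtain ⟨v, rfl⟩ := hη
      filter_upwards [Filter.eventually_gt_atTop v.1] with N hN
      rw [levelProj_basisVec, if_neg (not_le.mpr hN)]
  rw [Metric.tendsto_nhds]
  intro ε hε
  obtain ⟨η, hd, hη⟩ := Metric.dense_iff.mp dense_span_basisVec ξ ε hε
  filter_upwards [hspan η hη] with N hN
  have h : levelProj s N ξ = levelProj s N (ξ - η) := by rw [map_sub, hN, sub_zero]
  rw [dist_zero_right, h]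
  refine (norm_levelProj_apply_le N _).trans_lt ?_
  rwa [Metric.mem_ball, dist_comm, dist_eq_norm] at hd

/-- Contractions that tend to zero pointwise do so uniformly on totally bounded sets, such as the
image of the unit ball under `a`. An `ε / 4`-net suffices: net error and value at the net point add
up to `ε / 2`. -/
theorem tendsto_norm_levelProj_mul {a : L2 (Ball s) →L[ℂ] L2 (Ball s)} (ha : IsCompactOperator a) :
    Filter.Tendsto (fun N => ‖levelProj s N * a‖) Filter.atTop (nhds 0) := by
  rw [Metric.tendsto_atTop]
  intro ε hε
  have hT := (ha.isCompact_closure_image_closedBall (f := (a : L2 (Ball s) →ₗ[ℂ] L2 (Ball s)))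
    1).totallyBounded.subset subset_closure
  obtain ⟨t, -, hfin, hcov⟩ := Metric.finite_approx_of_totallyBounded hT (ε / 4) (by positivity)
  have hev : ∀ᶠ N in Filter.atTop, ∀ y ∈ t, ‖levelProj s N y‖ < ε / 4 :=
    (Filter.eventually_all_finite hfin).mpr fun y _ =>
      (by simpa using (tendsto_levelProj y).norm : Filter.Tendsto (fun N => ‖levelProj s N y‖)
        Filter.atTop (nhds 0)).eventually_lt_const (by positivity)
  obtain ⟨N₀, hN₀⟩ := Filter.eventually_atTop.mp hev
  refine ⟨N₀, fun N hN => ?_⟩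
  have hb : ‖levelProj s N * a‖ ≤ ε / 2 := by
    refine ContinuousLinearMap.opNorm_le_of_unit_norm (by positivity) fun x hx => ?_
    obtain ⟨y, hy, hxy⟩ := Set.mem_iUnion₂.mp (hcov ⟨x, by simp [hx], rfl⟩)
    rw [Metric.mem_ball, dist_eq_norm] at hxy
    have h1 : levelProj s N (a x) = levelProj s N (a x - y) + levelProj s N y := by
      rw [← map_add, sub_add_cancel]
    change ‖levelProj s N (a x)‖ ≤ _
    rw [h1]
    have h2 := norm_levelProj_apply_le N (a x - y)
    have h3 := hN₀ N hN y hy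
    have h4 := norm_add_le (levelProj s N (a x - y)) (levelProj s N y)
    change ‖a x - y‖ < _ at hxy
    linarith
  rw [Real.dist_eq, sub_zero, abs_of_nonneg (norm_nonneg _)]
  linarith

theorem tendsto_norm_mul_levelProj {a : L2 (Ball s) →L[ℂ] L2 (Ball s)} (ha : IsCompactOperator a) :
    Filter.Tendsto (fun N => ‖a * levelProj s N‖) Filter.atTop (nhds 0) := by
  refine (tendsto_norm_levelProj_mul (isCompactOperator_star ha)).congr fun N => ?_
  rw [← norm_star, star_mul, star_star, star_levelProj]

theorem finite_level_lt (s N : ℕ) : {v : Ball s | v.1 < N}.Finite := by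
  have : {v : Ball s | v.1 < N} = (Finset.range N).sigma fun n => (Finset.univ : Finset (Fin (s ^ n))) := by
    ext v; simp
  rw [this]
  exact Finset.finite_toSet _

theorem one_sub_levelProj (N : ℕ) : 1 - levelProj s N
    = ∑ v ∈ (finite_level_lt s N).toFinset, InnerProductSpace.rankOne ℂ (basisVec v) (basisVec v) := by
  refine ext_basisVec fun w => ?_
  rw [_root_.sum_apply]
  simp only [InnerProductSpace.rankOne_apply, orthonormal_iff_ite.mp orthonormal_basisVec]
  simp only [ite_smul, one_smul, zero_smul]
  rw [Finset.sum_ite_eq', _root_.sub_apply, levelProj_basisVec, one_apply_eq_self]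
  by_cases h : N ≤ w.1 <;> simp [h]

theorem isCompactOperator_one_sub_levelProj (N : ℕ) :
    IsCompactOperator (1 - levelProj s N : L2 (Ball s) →L[ℂ] L2 (Ball s)) := by
  rw [one_sub_levelProj]
  exact Submodule.sum_mem (compactOperator (RingHom.id ℂ) (L2 (Ball s)) (L2 (Ball s)))
    fun v _ => isCompactOperator_rankOne _ _

theorem gaugeAction_levelProj (N : ℕ) (θ : ℝ) : gaugeAction s θ (levelProj s N) = levelProj s N := by
  have h : gaugeUnitary s θ * levelProj s N = levelProj s N * gaugeUnitary s θ := by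
    refine ext_basisVec fun v => ?_
    change gaugeUnitary s θ (levelProj s N (basisVec v)) = levelProj s N (gaugeUnitary s θ (basisVec v))
    rw [gaugeUnitary_basisVec, map_smul, levelProj_basisVec]
    split_ifs
    · rw [gaugeUnitary_basisVec]
    · simp
  rw [gaugeAction, h, mul_assoc, gaugeUnitary_mul_neg, mul_one]

variable [NeZero s]

theorem one_sub_levelProj_mem_serreIdealAlgebra (N : ℕ) :
    1 - levelProj s N ∈ serreIdealAlgebra s := by
  have h : 1 - levelProj s N ∈ invCompact s := by
    refine ⟨isCompactOperator_one_sub_levelProj N, fun θ => ?_⟩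
    have h1 : gaugeAction s θ (1 - levelProj s N)
        = gaugeUnitary s θ * 1 * gaugeUnitary s (-θ) - gaugeAction s θ (levelProj s N) := by
      simp only [gaugeAction, mul_sub, sub_mul]
    rw [h1, gaugeAction_levelProj, mul_one, gaugeUnitary_mul_neg]
  simpa using mul_pow_mem_serreIdealAlgebra h 0

/-- The compact operators form a norm closed, selfadjoint ideal of `B(H)`, and every generator has a
compact factor. -/
theorem isCompactOperator_of_mem_serreIdealAlgebra {a : L2 (Ball s) →L[ℂ] L2 (Ball s)}
    (ha : a ∈ serreIdealAlgebra s) : IsCompactOperator a := by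
  refine closure_minimal (fun b hb => ?_)
    (isClosed_setOfPred_isCompactOperator (σ₁₂ := RingHom.id ℂ)
      (M₁ := L2 (Ball s)) (M₂ := L2 (Ball s))) ha
  change b ∈ NonUnitalAlgebra.adjoin ℂ _ at hb
  change IsCompactOperator b
  induction hb using NonUnitalAlgebra.adjoin_induction with
  | mem b hb =>
    rcases hb with ⟨a, ha, n, rfl⟩ | hb
    · exact ha.1.comp_clm (serreShift s ^ n)
    · obtain ⟨a, ha, n, h⟩ := Set.mem_star.mp hb
      rw [← star_star b, h]
      exact isCompactOperator_star (ha.1.comp_clm (serreShift s ^ n))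
  | add y z _ _ hy hz => exact hy.add hz
  | zero => exact isCompactOperator_zero
  | mul y z _ _ hy hz => exact hy.comp_clm z
  | smul c y _ hy => exact hy.smul c

end LevelProjection

/-! ### Digits of children and locally constant functions -/

section Digits

variable {s : ℕ} [NeZero s]

theorem Ball.child_digit_of_lt (v : Ball s) (j : Fin s) {i : ℕ} (hi : i < v.1) :
    SAdic.ofNat s (v.child j).2 i = SAdic.ofNat s v.2 i := by
  refine Fin.ext ?_
  change ((v.2 : ℕ) + j * s ^ v.1) / s ^ i % s = (v.2 : ℕ) / s ^ i % s
  obtain ⟨d, hd⟩ := Nat.exists_eq_add_of_lt hi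
  -- The term added in passing to a child is a multiple of `s ^ (i + 1)`, so it does not affect
  -- digit `i`.
  have h : (j : ℕ) * s ^ v.1 = s ^ i * (s * (j * s ^ d)) := by rw [hd]; ring
  rw [h, Nat.add_mul_div_left _ _ (pow_pos (Nat.pos_of_ne_zero (NeZero.ne s)) i),
    Nat.add_mul_mod_self_left]

theorem Ball.child_digit_self (v : Ball s) (j : Fin s) : SAdic.ofNat s (v.child j).2 v.1 = j := by
  refine Fin.ext ?_
  change ((v.2 : ℕ) + j * s ^ v.1) / s ^ v.1 % s = j
  rw [Nat.add_mul_div_right _ _ (pow_pos (Nat.pos_of_ne_zero (NeZero.ne s)) _),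
    Nat.div_eq_of_lt v.2.2, zero_add, Nat.mod_eq_of_lt j.2]

theorem Ball.exists_child (n : ℕ) (x : Fin (s ^ (n + 1))) :
    ∃ (v : Ball s) (j : Fin s), v.1 = n ∧ v.child j = ⟨n + 1, x⟩ := by
  have hpos : 0 < s ^ n := pow_pos (Nat.pos_of_ne_zero (NeZero.ne s)) n
  refine ⟨⟨n, ⟨x % s ^ n, Nat.mod_lt _ hpos⟩⟩, ⟨x / s ^ n, ?_⟩, rfl, ?_⟩
  · rw [Nat.div_lt_iff_lt_mul hpos, mul_comm, ← pow_succ]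
    exact x.2
  · simp only [Ball.child, Sigma.mk.injEq, heq_eq_eq, true_and]
    exact Fin.ext (Nat.mod_add_div' _ _)

/-- The ball `(0, 0)`, which is all of `ℤ_s`. -/
def Ball.root (s : ℕ) : Ball s := ⟨0, ⟨0, by simp⟩⟩

omit [NeZero s] in
theorem Ball.eq_root {v : Ball s} (hv : v.1 = 0) : v = Ball.root s := by
  obtain ⟨n, x⟩ := v
  change n = 0 at hv
  subst hv
  have hx := x.2
  simp only [Ball.root, Sigma.mk.injEq, heq_eq_eq, true_and]
  refine Fin.ext ?_
  simpa using hx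

/-- The continuous function that applies `g` to the `i`-th digit. -/
def digitFun (i : ℕ) (g : Fin s → ℂ) : C(SAdic s, ℂ) where
  toFun x := g (x i)
  continuous_toFun := (continuous_of_discreteTopology (f := g)).comp (continuous_apply i)

/-- `f` depends on the first `N` digits only. -/
def DependsOnDigits (f : C(SAdic s, ℂ)) (N : ℕ) : Prop :=
  ∀ x y : SAdic s, (∀ i < N, x i = y i) → f x = f y

omit [NeZero s] in
theorem DependsOnDigits.mono {f : C(SAdic s, ℂ)} {M N : ℕ} (h : DependsOnDigits f M)
    (hMN : M ≤ N) : DependsOnDigits f N :=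
  fun x y hxy => h x y fun i hi => hxy i (hi.trans_le hMN)

omit [NeZero s] in
theorem dependsOnDigits_digitFun (i : ℕ) (g : Fin s → ℂ) :
    DependsOnDigits (digitFun i g) (i + 1) :=
  fun _ _ hxy => congrArg g (hxy i i.lt_succ_self)

/-- The locally constant functions on `ℤ_s`. -/
def locallyConstant (s : ℕ) : StarSubalgebra ℂ C(SAdic s, ℂ) where
  carrier := {f | ∃ N, DependsOnDigits f N}
  mul_mem' := by
    rintro f g ⟨M, hf⟩ ⟨N, hg⟩
    refine ⟨max M N, fun x y hxy => ?_⟩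
    rw [ContinuousMap.mul_apply, ContinuousMap.mul_apply, hf.mono (le_max_left M N) x y hxy,
      hg.mono (le_max_right M N) x y hxy]
  add_mem' := by
    rintro f g ⟨M, hf⟩ ⟨N, hg⟩
    refine ⟨max M N, fun x y hxy => ?_⟩
    rw [ContinuousMap.add_apply, ContinuousMap.add_apply, hf.mono (le_max_left M N) x y hxy,
      hg.mono (le_max_right M N) x y hxy]
  algebraMap_mem' c := ⟨0, fun x y _ => rfl⟩
  star_mem' := by
    rintro f ⟨N, hf⟩
    exact ⟨N, fun x y hxy => congrArg star (hf x y hxy)⟩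

/-- Stone–Weierstrass: two distinct points differ in some digit, and that digit, read as a complex
number, is a locally constant function. -/
theorem topologicalClosure_locallyConstant (s : ℕ) [NeZero s] :
    (locallyConstant s).topologicalClosure = ⊤ := by
  refine ContinuousMap.starSubalgebra_topologicalClosure_eq_top_of_separatesPoints _ ?_
  intro x y hxy
  obtain ⟨i, hi⟩ := Function.ne_iff.mp hxy
  refine ⟨digitFun i fun j => ((j : ℕ) : ℂ), ⟨_, ⟨i + 1, dependsOnDigits_digitFun i _⟩, rfl⟩, ?_⟩
  change ((x i : ℕ) : ℂ) ≠ ((y i : ℕ) : ℂ)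
  exact fun h => hi (Fin.ext (Nat.cast_injective h))

end Digits

/-! ### Relations between the shift, the functions and the levels -/

section Shift

variable {s : ℕ} [NeZero s]

theorem mulOp_serreVec (f : C(SAdic s, ℂ)) (v : Ball s) :
    mulOp s f (serreVec s v) = ((1 / Real.sqrt s : ℝ) : ℂ) •
      ∑ j : Fin s, f (SAdic.ofNat s (v.child j).2) • basisVec (v.child j) := by
  simp only [serreVec, map_smul, map_sum, mulOp_basisVec]

theorem mulOp_serreVec_of_dependsOnDigits {f : C(SAdic s, ℂ)} {N : ℕ} (hf : DependsOnDigits f N)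
    {v : Ball s} (hv : N ≤ v.1) :
    mulOp s f (serreVec s v) = f (SAdic.ofNat s v.2) • serreVec s v := by
  have h : ∀ j : Fin s, f (SAdic.ofNat s (v.child j).2) = f (SAdic.ofNat s v.2) := fun j =>
    hf _ _ fun i hi => Ball.child_digit_of_lt v j (hi.trans_le hv)
  rw [mulOp_serreVec]
  simp only [h, ← Finset.smul_sum]
  rw [serreVec, smul_comm]

theorem mulRep_mul_levelProj (f : C(SAdic s, ℂ)) (N : ℕ) :
    mulRep s f * levelProj s N = levelProj s N * mulRep s f := by
  refine ext_basisVec fun v => ?_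
  change mulOp s f (levelProj s N (basisVec v)) = levelProj s N (mulOp s f (basisVec v))
  rw [levelProj_basisVec, mulOp_basisVec, map_smul, levelProj_basisVec]
  split_ifs
  · rw [mulOp_basisVec]
  · simp

/-- From level `N` on, a ball and its children share the first `N` digits, so `f` takes one value on
all of them. This is the commutation behind both norm bounds. -/
theorem mulRep_mul_shift_mul_levelProj {f : C(SAdic s, ℂ)} {N : ℕ} (hf : DependsOnDigits f N) :
    mulRep s f * (serreShift s * levelProj s N) = serreShift s * levelProj s N * mulRep s f := by
  refine ext_basisVec fun v => ?_
  change mulOp s f (serreShift s (levelProj s N (basisVec v)))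
    = serreShift s (levelProj s N (mulOp s f (basisVec v)))
  rw [levelProj_basisVec, mulOp_basisVec, map_smul, levelProj_basisVec, map_smul]
  split_ifs with h
  · rw [serreShift_basisVec, mulOp_serreVec_of_dependsOnDigits hf h]
  · simp

theorem levelProj_succ_mul_shift (N : ℕ) :
    levelProj s (N + 1) * serreShift s = serreShift s * levelProj s N := by
  refine ext_basisVec fun v => ?_
  change levelProj s (N + 1) (serreShift s (basisVec v))
    = serreShift s (levelProj s N (basisVec v))
  rw [levelProj_basisVec, serreShift_basisVec]
  simp only [serreVec, map_smul, map_sum, levelProj_basisVec, Ball.child, Nat.add_le_add_iff_right]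
  split_ifs with h
  · rw [serreShift_basisVec]; rfl
  · simp

theorem levelProj_mul_shift_mul_levelProj (N : ℕ) :
    levelProj s N * serreShift s * levelProj s N = serreShift s * levelProj s N := by
  rw [mul_assoc, ← levelProj_succ_mul_shift, ← mul_assoc, levelProj_mul,
    max_eq_right (Nat.le_succ N)]

theorem levelProj_mul_shift_pow (k : ℕ) : levelProj s k * serreShift s ^ k = serreShift s ^ k := by
  induction k with
  | zero => rw [levelProj_zero, one_mul]
  | succ k ih => rw [pow_succ', ← mul_assoc, levelProj_succ_mul_shift, mul_assoc, ih]

theorem norm_serreShift_apply (ξ : L2 (Ball s)) : ‖serreShift s ξ‖ = ‖ξ‖ :=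
  (isometryOfOrthonormal (orthonormal_serreVec s)).norm_map ξ

theorem norm_star_serreShift_pow_le (k : ℕ) : ‖star (serreShift s) ^ k‖ ≤ 1 := by
  have h : ‖serreShift s ^ k‖ ≤ 1 := by
    refine ContinuousLinearMap.opNorm_le_bound _ zero_le_one fun ξ => ?_
    rw [one_mul]
    induction k with
    | zero => simp
    | succ k ih =>
      rw [pow_succ']
      exact (norm_serreShift_apply _).trans_le ih
  rwa [← norm_star, star_pow, star_star]

/-- The range of `W ^ k` lies in the levels at least `k`, so `W* ^ k = W* ^ k P_k`, and `P_k` tends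
to zero strongly. This purity makes the Wold decomposition free of a unitary part. -/
theorem tendsto_star_serreShift_pow (ξ : L2 (Ball s)) :
    Filter.Tendsto (fun k => (star (serreShift s) ^ k) ξ) Filter.atTop (nhds 0) := by
  refine squeeze_zero_norm (fun k => ?_) (by simpa using (tendsto_levelProj ξ).norm)
  have h : star (serreShift s) ^ k = star (serreShift s) ^ k * levelProj s k := by
    rw [← star_pow, ← star_levelProj, ← star_mul, levelProj_mul_shift_pow]
  rw [h]
  change ‖(star (serreShift s) ^ k) (levelProj s k ξ)‖ ≤ _
  simpa using (star (serreShift s) ^ k).le_of_opNorm_le (norm_star_serreShift_pow_le k)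
    (levelProj s k ξ)

end Shift

/-! ### The algebra `A_W` contains the compact operators -/

section CompactOperators

variable {s : ℕ} [NeZero s]

theorem serreShift_mem_serreAlgebra : serreShift s ∈ serreAlgebra s :=
  StarSubalgebra.le_topologicalClosure _ (StarAlgebra.subset_adjoin ℂ _ (Or.inl rfl))

theorem mulRep_mem_serreAlgebra (f : C(SAdic s, ℂ)) : mulRep s f ∈ serreAlgebra s :=
  StarSubalgebra.le_topologicalClosure _ (StarAlgebra.subset_adjoin ℂ _ (Or.inr ⟨f, rfl⟩))

theorem isClosed_serreAlgebra :
    IsClosed (serreAlgebra s : Set (L2 (Ball s) →L[ℂ] L2 (Ball s))) :=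
  StarSubalgebra.isClosed_topologicalClosure _

theorem inv_sqrt_ne_zero : ((1 / Real.sqrt s : ℝ) : ℂ) ≠ 0 := by
  have : (0 : ℝ) < s := by exact_mod_cast Nat.pos_of_ne_zero (NeZero.ne s)
  exact_mod_cast (by positivity : (1 / Real.sqrt s) ≠ 0)

/-- A function `f` of digit zero commutes with `W` at every level except zero, where there is a
single ball. The commutator `X` is therefore of rank one, and `star X * X` is a multiple of the
projection onto the root vector. -/
theorem rankOne_root_mem_serreAlgebra (hs : 2 ≤ s) :
    InnerProductSpace.rankOne ℂ (basisVec (Ball.root s)) (basisVec (Ball.root s))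
      ∈ serreAlgebra s := by
  set f : C(SAdic s, ℂ) := digitFun 0 (fun j => if j = 0 then 1 else 0) with hf
  set X := serreShift s * mulRep s f - mulRep s f * serreShift s with hX
  set u := X (basisVec (Ball.root s)) with hu
  have hXmem : X ∈ serreAlgebra s :=
    sub_mem (mul_mem serreShift_mem_serreAlgebra (mulRep_mem_serreAlgebra f))
      (mul_mem (mulRep_mem_serreAlgebra f) serreShift_mem_serreAlgebra)
  have happ : ∀ v, X (basisVec v) = f (SAdic.ofNat s v.2) • serreVec s v
      - mulOp s f (serreVec s v) := fun v => by
    rw [hX, _root_.sub_apply]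
    change serreShift s (mulOp s f (basisVec v)) - mulOp s f (serreShift s (basisVec v)) = _
    rw [mulOp_basisVec, map_smul, serreShift_basisVec]
  have hXr : X = InnerProductSpace.rankOne ℂ u (basisVec (Ball.root s)) := by
    refine ext_basisVec fun v => ?_
    rw [InnerProductSpace.rankOne_apply, orthonormal_iff_ite.mp orthonormal_basisVec]
    by_cases hv : v.1 = 0
    · rw [Ball.eq_root hv, if_pos rfl, one_smul]
    · rw [if_neg (fun h => hv (by rw [← h]; rfl)), zero_smul, happ,
        mulOp_serreVec_of_dependsOnDigits (dependsOnDigits_digitFun 0 _)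
          (Nat.one_le_iff_ne_zero.mpr hv), sub_self]
  have hu0 : u ≠ 0 := by
    have hroot : f (SAdic.ofNat s (Ball.root s).2) = 1 := by
      change (if Fin.ofNat s (0 / s ^ 0) = 0 then (1 : ℂ) else 0) = 1
      simp
    -- `u` is tested against the child with digit 1. There `f` vanishes whereas `f` is 1 at the
    -- root, so only the term `W M_f` contributes.
    let j : Fin s := ⟨1, hs⟩
    have hj : j ≠ 0 := fun h => by simpa [j] using congrArg Fin.val h
    have hinner : inner ℂ (basisVec ((Ball.root s).child j)) u = ((1 / Real.sqrt s : ℝ) : ℂ) := by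
      have key : ∀ k : Fin s, inner ℂ (basisVec ((Ball.root s).child j))
          (basisVec ((Ball.root s).child k)) = if j = k then (1 : ℂ) else 0 := fun k => by
        rw [orthonormal_iff_ite.mp orthonormal_basisVec]
        congr 1
        exact propext ⟨fun h => (Ball.child_injective h).2, fun h => h ▸ rfl⟩
      have hfj : f (SAdic.ofNat s ((Ball.root s).child j).2) = 0 := by
        change (if SAdic.ofNat s ((Ball.root s).child j).2 (Ball.root s).1 = 0 then (1 : ℂ) else 0)
          = 0
        rw [Ball.child_digit_self, if_neg hj]
      rw [hu, happ, mulOp_serreVec, hroot, one_smul, serreVec]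
      simp only [inner_sub_right, inner_smul_right, inner_sum, key, mul_ite, mul_one, mul_zero,
        Finset.sum_ite_eq, Finset.mem_univ, if_true, hfj, sub_zero]
    intro h
    rw [h, inner_zero_right] at hinner
    exact inv_sqrt_ne_zero hinner.symm
  have hXX : star X * X
      = inner ℂ u u • InnerProductSpace.rankOne ℂ (basisVec (Ball.root s)) (basisVec (Ball.root s)) := by
    rw [hXr, ContinuousLinearMap.star_eq_adjoint, InnerProductSpace.adjoint_rankOne]
    exact InnerProductSpace.rankOne_comp_rankOne ..
  have hne : inner ℂ u u ≠ 0 := inner_self_ne_zero.mpr hu0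
  have := (serreAlgebra s).smul_mem (mul_mem (star_mem hXmem) hXmem) (inner ℂ u u)⁻¹
  rwa [hXX, smul_smul, inv_mul_cancel₀ hne, one_smul] at this

/-- By induction on the level: `W` spreads a basis vector evenly over the children, and the
indicator of one value of the new digit selects a single child. -/
theorem exists_mem_serreAlgebra_root (v : Ball s) :
    ∃ T ∈ serreAlgebra s, T (basisVec (Ball.root s)) = basisVec v := by
  obtain ⟨n, x⟩ := v
  induction n with
  | zero => exact ⟨1, one_mem _, by rw [Ball.eq_root (v := ⟨0, x⟩) rfl]; rfl⟩
  | succ n ih =>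
    obtain ⟨⟨m, y⟩, j, rfl, hv⟩ := Ball.exists_child n x
    obtain ⟨T, hT, hTv⟩ := ih y
    refine ⟨((1 / Real.sqrt s : ℝ) : ℂ)⁻¹ • (mulRep s (digitFun m fun k => if k = j then 1 else 0)
      * serreShift s * T), (serreAlgebra s).smul_mem (mul_mem (mul_mem (mulRep_mem_serreAlgebra _)
        serreShift_mem_serreAlgebra) hT) _, ?_⟩
    rw [← hv, _root_.smul_apply]
    change _ • mulOp s _ (serreShift s (T _)) = _
    rw [hTv, serreShift_basisVec, mulOp_serreVec, smul_smul, inv_mul_cancel₀ inv_sqrt_ne_zero,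
      one_smul]
    have key : ∀ k : Fin s, digitFun m (fun k => if k = j then (1 : ℂ) else 0)
        (SAdic.ofNat s (Ball.child ⟨m, y⟩ k).2) = if k = j then 1 else 0 := fun k => by
      change (if SAdic.ofNat s (Ball.child ⟨m, y⟩ k).2 m = j then (1 : ℂ) else 0) = _
      rw [Ball.child_digit_self ⟨m, y⟩ k]
    simp only [key, ite_smul, one_smul, zero_smul, Finset.sum_ite_eq', Finset.mem_univ, if_true]

theorem rankOne_basisVec_mem_serreAlgebra (hs : 2 ≤ s) (v w : Ball s) :
    InnerProductSpace.rankOne ℂ (basisVec v) (basisVec w) ∈ serreAlgebra s := by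
  obtain ⟨S, hS, hSv⟩ := exists_mem_serreAlgebra_root v
  obtain ⟨T, hT, hTw⟩ := exists_mem_serreAlgebra_root w
  have h : S * InnerProductSpace.rankOne ℂ (basisVec (Ball.root s)) (basisVec (Ball.root s)) * star T
      = InnerProductSpace.rankOne ℂ (basisVec v) (basisVec w) := by
    rw [← hSv, ← hTw]
    change (S.comp _).comp _ = _
    rw [InnerProductSpace.comp_rankOne, InnerProductSpace.rankOne_comp,
      ContinuousLinearMap.star_eq_adjoint, ContinuousLinearMap.adjoint_adjoint]
  rw [← h]
  exact mul_mem (mul_mem hS (rankOne_root_mem_serreAlgebra hs)) (star_mem hT)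

/-- The Serre shift algebra contains all compact operators. -/
theorem mem_serreAlgebra_of_isCompactOperator (hs : 2 ≤ s)
    {a : L2 (Ball s) →L[ℂ] L2 (Ball s)} (ha : IsCompactOperator a) : a ∈ serreAlgebra s := by
  have hcorner : ∀ N, (1 - levelProj s N) * a * (1 - levelProj s N) ∈ serreAlgebra s := by
    intro N
    -- The corner is a finite matrix, hence a linear combination of matrix units.
    rw [one_sub_levelProj, Finset.sum_mul, Finset.sum_mul_sum]
    refine sum_mem fun v _ => sum_mem fun w _ => ?_
    have h : InnerProductSpace.rankOne ℂ (basisVec v) (basisVec v) * a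
        * InnerProductSpace.rankOne ℂ (basisVec w) (basisVec w)
        = inner ℂ (basisVec v) (a (basisVec w))
          • InnerProductSpace.rankOne ℂ (basisVec v) (basisVec w) := by
      rw [mul_assoc]
      change (InnerProductSpace.rankOne ℂ (basisVec v) (basisVec v)).comp (a.comp _) = _
      rw [InnerProductSpace.comp_rankOne, InnerProductSpace.rankOne_comp_rankOne]
    rw [h]
    exact (serreAlgebra s).smul_mem (rankOne_basisVec_mem_serreAlgebra hs v w) _
  have hlim : Filter.Tendsto (fun N => (1 - levelProj s N) * a * (1 - levelProj s N))
      Filter.atTop (nhds a) := by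
    rw [tendsto_iff_norm_sub_tendsto_zero]
    have h0 := (tendsto_norm_levelProj_mul ha).add
      ((tendsto_norm_mul_levelProj ha).add (tendsto_norm_levelProj_mul ha))
    rw [add_zero, add_zero] at h0
    refine squeeze_zero (fun _ => norm_nonneg _) (fun N => ?_) h0
    have e : (1 - levelProj s N) * a * (1 - levelProj s N) - a
        = -(levelProj s N * a) + (-(a * levelProj s N) + levelProj s N * a * levelProj s N) := by
      noncomm_ring
    rw [e]
    refine (norm_add_le _ _).trans ?_
    rw [norm_neg]
    refine add_le_add le_rfl ((norm_add_le _ _).trans ?_)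
    rw [norm_neg]
    refine add_le_add le_rfl ((norm_mul_le _ _).trans ?_)
    exact mul_le_of_le_one_right (norm_nonneg _) (norm_levelProj_le N)
  exact isClosed_serreAlgebra.mem_of_tendsto hlim (Filter.Eventually.of_forall hcorner)

theorem serreIdealAlgebra_le_serreAlgebra (hs : 2 ≤ s) :
    serreIdealAlgebra s ≤ (serreAlgebra s).toNonUnitalStarSubalgebra :=
  fun _ ha => mem_serreAlgebra_of_isCompactOperator hs (isCompactOperator_of_mem_serreIdealAlgebra ha)

end CompactOperators

/-! ### The unilateral shift and its adjoint -/

section UnilateralShift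

theorem unilateralShift_basisVec (k : ℕ) : unilateralShift (basisVec k) = basisVec (k + 1) :=
  isometryOfOrthonormal_basisVec orthonormal_shift k

theorem star_unilateralShift_mul_self : star unilateralShift * unilateralShift = 1 :=
  (ContinuousLinearMap.norm_map_iff_adjoint_comp_self _).mp
    (isometryOfOrthonormal orthonormal_shift).norm_map

theorem star_unilateralShift_basisVec_succ (k : ℕ) :
    star unilateralShift (basisVec (k + 1)) = basisVec k := by
  rw [← unilateralShift_basisVec]
  exact congrArg (fun T : L2 ℕ →L[ℂ] L2 ℕ => T (basisVec k)) star_unilateralShift_mul_self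

theorem star_unilateralShift_basisVec_zero : star unilateralShift (basisVec 0) = 0 := by
  refine dense_span_basisVec.eq_zero_of_inner_left (𝕜 := ℂ) fun v hv => ?_
  induction hv using Submodule.span_induction with
  | zero => simp
  | add v w _ _ hv hw => rw [inner_add_right, hv, hw, add_zero]
  | smul c v _ hv => rw [inner_smul_right, hv, mul_zero]
  | mem v hv =>
    obtain ⟨k, rfl⟩ := hv
    rw [ContinuousLinearMap.star_eq_adjoint, ContinuousLinearMap.adjoint_inner_left,
      unilateralShift_basisVec, orthonormal_iff_ite.mp orthonormal_basisVec, if_neg (by simp)]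

end UnilateralShift

/-! ### Wold decomposition on an invariant subspace -/

section Wold

variable {H : Type*} [NormedAddCommGroup H] [InnerProductSpace ℂ H] [CompleteSpace H]

/-- `Q` is the projection onto a subspace that is invariant under the pure isometry `W`. -/
structure IsInvariantProjection (W Q : H →L[ℂ] H) : Prop where
  isometry : star W * W = 1
  star_eq : star Q = Q
  mul_self : Q * Q = Q
  invariant : Q * W * Q = W * Q
  pure : ∀ ξ, Filter.Tendsto (fun k => (star W ^ k) ξ) Filter.atTop (nhds 0)

/-- The projection onto the wandering subspace of the restriction of `W` to the range of `Q`. -/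
def wanderingProj (W Q : H →L[ℂ] H) : H →L[ℂ] H := Q - W * Q * star W

namespace IsInvariantProjection

variable {W Q : H →L[ℂ] H} (h : IsInvariantProjection W Q)
include h

theorem proj_mul_star_mul_proj : Q * star W * Q = Q * star W := by
  have := congrArg star h.invariant
  simpa only [star_mul, h.star_eq, mul_assoc] using this

theorem star_wanderingProj : star (wanderingProj W Q) = wanderingProj W Q := by
  simp only [wanderingProj, star_sub, star_mul, star_star, h.star_eq, mul_assoc]

theorem wanderingProj_mul_proj : wanderingProj W Q * Q = wanderingProj W Q := by
  rw [wanderingProj, sub_mul, h.mul_self, mul_assoc, mul_assoc, ← mul_assoc Q,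
    h.proj_mul_star_mul_proj, mul_assoc]

theorem wanderingProj_mul_isometry_mul_proj : wanderingProj W Q * (W * Q) = 0 := by
  rw [wanderingProj, sub_mul, mul_assoc (W * Q), ← mul_assoc (star W), h.isometry, one_mul,
    mul_assoc W, h.mul_self, ← mul_assoc, h.invariant, sub_self]

theorem wanderingProj_mul_self : wanderingProj W Q * wanderingProj W Q = wanderingProj W Q := by
  nth_rewrite 2 [wanderingProj]
  rw [mul_sub, h.wanderingProj_mul_proj, ← mul_assoc, h.wanderingProj_mul_isometry_mul_proj,
    zero_mul, sub_zero]

/-- The wandering projection `D` is a projection with `D = Q* Q - (Q W*)* (Q W*)`. The identity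
telescopes along the orbit of `ξ` under `W*`. -/
theorem norm_sq_wanderingProj (ξ : H) :
    ‖wanderingProj W Q ξ‖ ^ 2 = ‖Q ξ‖ ^ 2 - ‖Q (star W ξ)‖ ^ 2 := by
  have key : ∀ T : H →L[ℂ] H, ((‖T ξ‖ ^ 2 : ℝ) : ℂ) = inner ℂ ξ ((star T * T) ξ) := fun T => by
    rw [ContinuousLinearMap.star_eq_adjoint]
    change _ = inner ℂ ξ (ContinuousLinearMap.adjoint T (T ξ))
    rw [ContinuousLinearMap.adjoint_inner_right, inner_self_eq_norm_sq_to_K]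
    exact Complex.ofReal_pow _ _
  have e : star (wanderingProj W Q) * wanderingProj W Q
      = star Q * Q - star (Q * star W) * (Q * star W) := by
    rw [h.star_wanderingProj, h.wanderingProj_mul_self, star_mul, star_star, h.star_eq, h.mul_self,
      mul_assoc, ← mul_assoc Q, h.mul_self, wanderingProj, mul_assoc]
  have h1 : ((‖wanderingProj W Q ξ‖ ^ 2 : ℝ) : ℂ)
      = ((‖Q ξ‖ ^ 2 - ‖Q (star W ξ)‖ ^ 2 : ℝ) : ℂ) := by
    rw [key, e, _root_.sub_apply, inner_sub_right, ← key, ← key, Complex.ofReal_sub]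
    rfl
  exact_mod_cast h1

theorem sum_norm_sq_wanderingProj (ξ : H) (n : ℕ) :
    ∑ k ∈ Finset.range n, ‖wanderingProj W Q ((star W ^ k) ξ)‖ ^ 2
      = ‖Q ξ‖ ^ 2 - ‖Q ((star W ^ n) ξ)‖ ^ 2 := by
  induction n with
  | zero => simp
  | succ n ih =>
    have e : (star W ^ (n + 1)) ξ = star W ((star W ^ n) ξ) := by rw [pow_succ']; rfl
    rw [Finset.sum_range_succ, ih, h.norm_sq_wanderingProj, e]
    ring

/-- The remainder of the telescoping sum tends to zero because `W` is pure. -/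
theorem hasSum_norm_sq_wanderingProj (ξ : H) :
    HasSum (fun k : ℕ => ‖wanderingProj W Q ((star W ^ k) ξ)‖ ^ 2) (‖Q ξ‖ ^ 2) := by
  rw [hasSum_iff_tendsto_nat_of_nonneg fun _ => by positivity]
  simp only [h.sum_norm_sq_wanderingProj]
  have h1 : Filter.Tendsto (fun n => ‖Q ((star W ^ n) ξ)‖ ^ 2) Filter.atTop (nhds 0) := by
    simpa using (((Q.continuous.tendsto 0).comp (h.pure ξ)).norm).pow 2
  simpa using tendsto_const_nhds.sub h1

theorem memℓp_wanderingProj (ξ : H) :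
    Memℓp (E := fun _ : ℕ => H) (fun k => wanderingProj W Q ((star W ^ k) ξ)) 2 := by
  refine memℓp_gen ?_
  simpa using (h.hasSum_norm_sq_wanderingProj ξ).summable

/-- The components of a vector in the Wold decomposition. -/
def woldComponents : H →ₗ[ℂ] lp (fun _ : ℕ => H) 2 where
  toFun ξ := ⟨fun k => wanderingProj W Q ((star W ^ k) ξ), h.memℓp_wanderingProj ξ⟩
  map_add' ξ η := lp.ext (funext fun k => by
    change wanderingProj W Q ((star W ^ k) (ξ + η)) = wanderingProj W Q ((star W ^ k) ξ)
      + wanderingProj W Q ((star W ^ k) η)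
    rw [map_add, map_add])
  map_smul' c ξ := lp.ext (funext fun k => by
    change wanderingProj W Q ((star W ^ k) (c • ξ)) = c • wanderingProj W Q ((star W ^ k) ξ)
    rw [map_smul, map_smul])

theorem norm_woldComponents (ξ : H) : ‖h.woldComponents ξ‖ = ‖Q ξ‖ := by
  have h1 := lp.norm_rpow_eq_tsum (p := 2) (by simp) (h.woldComponents ξ)
  have h2 : ‖h.woldComponents ξ‖ ^ 2 = ‖Q ξ‖ ^ 2 := by
    rw [← (h.hasSum_norm_sq_wanderingProj ξ).tsum_eq]
    simp only [ENNReal.toReal_ofNat, Real.rpow_ofNat] at h1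
    exact h1
  exact (sq_eq_sq₀ (norm_nonneg _) (norm_nonneg _)).mp h2

omit h in
theorem orthogonalFamily_tmulIsometry :
    OrthogonalFamily ℂ (fun _ : ℕ => H) fun k : ℕ =>
      tmulIsometry (K := H) (basisVec k : L2 ℕ) (norm_basisVec k) := by
  intro k l hkl x y
  rw [tmulIsometry_apply, tmulIsometry_apply, HilbertTensor.inner_tmul,
    orthonormal_iff_ite.mp orthonormal_basisVec, if_neg hkl, zero_mul]

/-- The Wold embedding, which identifies `W` on the range of `Q` with an amplification of the
unilateral shift. -/
def wold : H →ₗ[ℂ] HilbertTensor (L2 ℕ) H :=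
  (orthogonalFamily_tmulIsometry (H := H)).linearIsometry.toLinearMap ∘ₗ h.woldComponents

/-- The target is `ℓ²(ℕ) ⊗ H` with all of `H`, not just the wandering subspace. The map is thus only
a partial isometry with initial projection `Q`, but the operators on its target are literally the
symbols `S ⊗ 1` and `1 ⊗ M_f`. -/
theorem norm_wold (ξ : H) : ‖h.wold ξ‖ = ‖Q ξ‖ :=
  ((orthogonalFamily_tmulIsometry (H := H)).linearIsometry.norm_map _).trans
    (h.norm_woldComponents ξ)

theorem hasSum_wold (ξ : H) :
    HasSum (fun k : ℕ => HilbertTensor.tmul (basisVec k : L2 ℕ)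
      (wanderingProj W Q ((star W ^ k) ξ))) (h.wold ξ) :=
  (orthogonalFamily_tmulIsometry (H := H)).hasSum_linearIsometry (h.woldComponents ξ)

theorem proj_mul_star_pow_mul_proj (k : ℕ) : Q * star W ^ k * Q = Q * star W ^ k := by
  induction k with
  | zero => rw [pow_zero, mul_one, h.mul_self]
  | succ k ih =>
    rw [pow_succ, ← mul_assoc, ← ih, mul_assoc (Q * star W ^ k), mul_assoc (Q * star W ^ k),
      h.proj_mul_star_mul_proj]

theorem wanderingProj_mul_star_pow_mul_proj (k : ℕ) :
    wanderingProj W Q * star W ^ k * Q = wanderingProj W Q * star W ^ k := by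
  rw [← h.wanderingProj_mul_proj, mul_assoc (wanderingProj W Q), mul_assoc,
    h.proj_mul_star_pow_mul_proj]

theorem wold_isometry (ξ : H) :
    h.wold ((W * Q) ξ) = opTensor unilateralShift 1 (h.wold ξ) := by
  have h1 := (hasSum_nat_add_iff' 1).mpr (h.hasSum_wold ((W * Q) ξ))
  -- Component zero of `W Q ξ` vanishes since `D W Q = 0`, and component `k + 1` is component `k` of
  -- `ξ`.
  have h0 : wanderingProj W Q ((star W ^ 0) ((W * Q) ξ)) = 0 :=
    congrArg (fun T : H →L[ℂ] H => T ξ) h.wanderingProj_mul_isometry_mul_proj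
  rw [Finset.sum_range_one, h0, ← HilbertTensor.mk_apply, map_zero, sub_zero] at h1
  have h2 := (h.hasSum_wold ξ).mapL (opTensor unilateralShift 1)
  simp only [opTensor_tmul, unilateralShift_basisVec, one_apply_eq_self] at h2
  refine h1.unique ?_
  convert h2 using 3 with k
  have e : wanderingProj W Q * star W ^ (k + 1) * (W * Q) = wanderingProj W Q * star W ^ k := by
    rw [pow_succ, ← mul_assoc (wanderingProj W Q), mul_assoc, ← mul_assoc (star W), h.isometry, one_mul,
      h.wanderingProj_mul_star_pow_mul_proj]
  exact congrArg (fun T : H →L[ℂ] H => T ξ) e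

/-- No cut-off by `Q` is needed: the components are `D W* ^ k ξ`, and replacing `ξ` by `W* ξ` only
drops the first one. -/
theorem wold_star_isometry (ξ : H) :
    h.wold (star W ξ) = opTensor (star unilateralShift) 1 (h.wold ξ) := by
  have h1 := (hasSum_nat_add_iff' 1).mpr
    ((h.hasSum_wold ξ).mapL (opTensor (star unilateralShift) 1))
  simp only [opTensor_tmul, Finset.sum_range_one, star_unilateralShift_basisVec_zero,
    star_unilateralShift_basisVec_succ, one_apply_eq_self] at h1
  rw [← HilbertTensor.mk_apply, map_zero, LinearMap.zero_apply, sub_zero] at h1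
  exact (h.hasSum_wold (star W ξ)).unique h1

/-- The hypothesis on `star M` says, after taking adjoints, that `M` commutes with `Q W*`. The
operators `D` and `Q W* ^ k` are built from `Q`, `W Q` and `Q W*`, so `M` commutes with them as
well. -/
theorem wanderingProj_mul_star_pow_commute {M : H →L[ℂ] H} (hQ : M * Q = Q * M)
    (hW : M * (W * Q) = W * Q * M) (hW' : star M * (W * Q) = W * Q * star M) (k : ℕ) :
    wanderingProj W Q * star W ^ k * M = M * (wanderingProj W Q * star W ^ k) := by
  have hstar : Q * star W * M = M * (Q * star W) := by
    have := congrArg star hW'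
    simpa only [star_mul, star_star, h.star_eq, mul_assoc] using this
  have hD : wanderingProj W Q * M = M * wanderingProj W Q := by
    -- Inserting a second `Q` writes the subtracted term of `D` as `(W Q) (Q W*)`, a product of
    -- operators that commute with `M`.
    have e : W * Q * star W = W * Q * (Q * star W) := by
      rw [← mul_assoc (W * Q), mul_assoc W Q Q, h.mul_self]
    rw [wanderingProj, e, sub_mul, mul_sub, hQ, mul_assoc (W * Q), hstar, ← mul_assoc, ← hW,
      mul_assoc M]
  have hpow : Q * star W ^ k * M = M * (Q * star W ^ k) := by
    induction k with
    | zero => rw [pow_zero, mul_one, hQ]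
    | succ k ih =>
      rw [pow_succ, ← mul_assoc, ← h.proj_mul_star_pow_mul_proj, mul_assoc (Q * star W ^ k),
        mul_assoc (Q * star W ^ k), hstar, ← mul_assoc, ih, mul_assoc M]
  rw [← h.wanderingProj_mul_proj, mul_assoc (wanderingProj W Q), mul_assoc, hpow, ← mul_assoc, hD,
    mul_assoc M]

theorem wold_commutant {M : H →L[ℂ] H} (hQ : M * Q = Q * M) (hW : M * (W * Q) = W * Q * M)
    (hW' : star M * (W * Q) = W * Q * star M) (ξ : H) :
    h.wold (M ξ) = opTensor 1 M (h.wold ξ) := by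
  have h1 := (h.hasSum_wold ξ).mapL (opTensor 1 M)
  simp only [opTensor_tmul, one_apply_eq_self] at h1
  refine (h.hasSum_wold (M ξ)).unique ?_
  convert h1 using 3 with k
  exact congrArg (fun T : H →L[ℂ] H => T ξ) (h.wanderingProj_mul_star_pow_commute hQ hW hW' k)

end IsInvariantProjection

end Wold

/-! ### Translates of wandering vectors -/

section WanderingVectors

variable {H : Type*} [NormedAddCommGroup H] [InnerProductSpace ℂ H] [CompleteSpace H]
  {κ : Type*} [DecidableEq κ] {W : H →L[ℂ] H} {w : κ → H}

theorem inner_isometry (hW : star W * W = 1) (x y : H) : inner ℂ (W x) (W y) = inner ℂ x y := by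
  rw [← ContinuousLinearMap.adjoint_inner_right, ← ContinuousLinearMap.star_eq_adjoint]
  exact congrArg (inner ℂ x) (congrArg (fun T : H →L[ℂ] H => T y) hW)

/-- The translates of an orthonormal family of wandering vectors of an isometry. -/
theorem orthonormal_pow_apply (hW : star W * W = 1) (hw : Orthonormal ℂ w)
    (hker : ∀ j, star W (w j) = 0) : Orthonormal ℂ fun p : ℕ × κ => (W ^ p.1) (w p.2) := by
  have hsucc : ∀ (k : ℕ) (x : H), (W ^ (k + 1)) x = W ((W ^ k) x) := fun k x => by
    rw [pow_succ']; rfl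
  have hzero : ∀ (x : H) (j : κ), inner ℂ (W x) (w j) = 0 := fun x j => by
    rw [← ContinuousLinearMap.adjoint_inner_right, ← ContinuousLinearMap.star_eq_adjoint, hker,
      inner_zero_right]
  have key : ∀ (k l : ℕ) (i j : κ), inner ℂ ((W ^ k) (w i)) ((W ^ l) (w j))
      = if k = l ∧ i = j then (1 : ℂ) else 0 := by
    intro k
    -- Equal powers of `W` cancel by isometry; when one exponent reaches zero before the other, the
    -- range of `W` meets a wandering vector and the inner product vanishes.
    induction k with
    | zero =>
      intro l i j
      cases l with
      | zero => simpa using orthonormal_iff_ite.mp hw i j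
      | succ l =>
        rw [hsucc, if_neg (by simp)]
        exact inner_eq_zero_symm.mp (hzero _ _)
    | succ k ih =>
      intro l i j
      cases l with
      | zero =>
        rw [hsucc, if_neg (by simp)]
        exact hzero _ _
      | succ l =>
        rw [hsucc, hsucc, inner_isometry hW, ih]
        simp
  rw [orthonormal_iff_ite]
  intro p q
  rw [key]
  simp only [Prod.ext_iff]

end WanderingVectors

/-! ### Copies of `S ⊗ 1` and `1 ⊗ M_f` inside high levels -/

section SerreWandering

variable {s : ℕ} [NeZero s]

/-- The ball `(m, x)`, seen as the ball `(n + ⟨m, x⟩, x)`, where `⟨m, x⟩` is the pairing function. -/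
def deepBall (n : ℕ) (v : Ball s) : Ball s :=
  ⟨n + Nat.pair v.1 v.2, ⟨v.2, v.2.2.trans_le (Nat.pow_le_pow_right
    (Nat.pos_of_ne_zero (NeZero.ne s)) ((Nat.left_le_pair _ _).trans (Nat.le_add_left _ _)))⟩⟩

/-- A deep ball keeps the integer `x`, hence the value `f(x)`, and balls of different levels may
share `x`. The pairing function stores `(m, x)` in the level and keeps them apart. -/
theorem deepBall_injective (n : ℕ) : Function.Injective (deepBall (s := s) n) := by
  rintro ⟨m, x⟩ ⟨m', x'⟩ h
  have h1 : n + Nat.pair m x = n + Nat.pair m' x' := congrArg Sigma.fst h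
  obtain ⟨rfl, h2⟩ := Nat.pair_eq_pair.mp (Nat.add_left_cancel h1)
  rw [Fin.ext h2]

/-- A unit vector in the kernel of `W*`, supported on the children of the ball `v`. -/
def wanderingVec (hs : 2 ≤ s) (v : Ball s) : L2 (Ball s) :=
  ((1 / Real.sqrt 2 : ℝ) : ℂ) •
    (basisVec (v.child ⟨0, by omega⟩) - basisVec (v.child ⟨1, hs⟩))

omit [NeZero s] in
theorem inner_basisVec_child (v w : Ball s) (j k : Fin s) :
    inner ℂ (basisVec (v.child j)) (basisVec (w.child k))
      = if v = w ∧ j = k then (1 : ℂ) else 0 := by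
  rw [orthonormal_iff_ite.mp orthonormal_basisVec]
  congr 1
  refine propext ⟨Ball.child_injective, ?_⟩
  rintro ⟨rfl, rfl⟩
  rfl

theorem orthonormal_wanderingVec (hs : 2 ≤ s) : Orthonormal ℂ (wanderingVec hs) := by
  rw [orthonormal_iff_ite]
  intro v w
  have h : ((1 / Real.sqrt 2 : ℝ) : ℂ) * (((1 / Real.sqrt 2 : ℝ) : ℂ) + ((1 / Real.sqrt 2 : ℝ) : ℂ)) = 1 := by
    have h2 := Real.mul_self_sqrt (zero_le_two (α := ℝ))
    have h0 : Real.sqrt 2 ≠ 0 := by positivity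
    have : (1 / Real.sqrt 2) * ((1 / Real.sqrt 2) + (1 / Real.sqrt 2)) = 1 := by
      field_simp
      linarith
    exact_mod_cast this
  simp only [wanderingVec, inner_smul_left, inner_smul_right, inner_sub_left, inner_sub_right,
    inner_basisVec_child, Complex.conj_ofReal]
  by_cases hvw : v = w
  · simpa [hvw] using h
  · simp [hvw]

/-- `W E_w` has equal coefficients on all children of `w`, so a difference of two children of `v` is
orthogonal to the range of `W`. -/
theorem star_serreShift_wanderingVec (hs : 2 ≤ s) (v : Ball s) :
    star (serreShift s) (wanderingVec hs v) = 0 := by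
  refine dense_span_basisVec.eq_zero_of_inner_left (𝕜 := ℂ) fun x hx => ?_
  induction hx using Submodule.span_induction with
  | zero => simp
  | add v w _ _ hv hw => rw [inner_add_right, hv, hw, add_zero]
  | smul c v _ hv => rw [inner_smul_right, hv, mul_zero]
  | mem x hx =>
    obtain ⟨w, rfl⟩ := hx
    rw [ContinuousLinearMap.star_eq_adjoint, ContinuousLinearMap.adjoint_inner_left,
      serreShift_basisVec]
    simp only [wanderingVec, serreVec, inner_smul_left, inner_smul_right, inner_sub_left, inner_sum,
      inner_basisVec_child]
    by_cases hvw : v = w <;> simp [hvw, ← Finset.mul_sum]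

omit [NeZero s] in
theorem levelProj_wanderingVec (hs : 2 ≤ s) {v : Ball s} {N : ℕ} (hv : N ≤ v.1 + 1) :
    levelProj s N (wanderingVec hs v) = wanderingVec hs v := by
  simp [wanderingVec, levelProj_basisVec, Ball.child, hv]

theorem mulOp_wanderingVec (hs : 2 ≤ s) {f : C(SAdic s, ℂ)} {N : ℕ} (hf : DependsOnDigits f N)
    {v : Ball s} (hv : N ≤ v.1) :
    mulOp s f (wanderingVec hs v) = f (SAdic.ofNat s v.2) • wanderingVec hs v := by
  have h : ∀ j : Fin s, f (SAdic.ofNat s (v.child j).2) = f (SAdic.ofNat s v.2) := fun j =>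
    hf _ _ fun i hi => Ball.child_digit_of_lt v j (hi.trans_le hv)
  rw [wanderingVec, map_smul, map_sub, mulOp_basisVec, mulOp_basisVec, h, h, ← smul_sub, smul_comm]

/-- The family of vectors `W^k w`, for wandering vectors `w` of level larger than `n`. -/
theorem orthonormal_translates (hs : 2 ≤ s) (n : ℕ) :
    Orthonormal ℂ fun p : ℕ × Ball s => (serreShift s ^ p.1) (wanderingVec hs (deepBall n p.2)) :=
  orthonormal_pow_apply (W := serreShift s) (w := fun v : Ball s => wanderingVec hs (deepBall n v))
    (star_serreShift_mul_self s)
    ((orthonormal_wanderingVec hs).comp (deepBall n) (deepBall_injective n))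
    fun v => star_serreShift_wanderingVec hs (deepBall n v)

/-- The isometry `E_k ⊗ E_v ↦ W^k w_v`, for wandering vectors `w_v` of level larger than `n` that are
supported near the centre of `v`. -/
def deepIsometry (hs : 2 ≤ s) (n : ℕ) : HilbertTensor (L2 ℕ) (L2 (Ball s)) →L[ℂ] L2 (Ball s) :=
  (tensorIsometry (orthonormal_translates hs n)).toContinuousLinearMap

theorem norm_deepIsometry (hs : 2 ≤ s) (n : ℕ) (z : HilbertTensor (L2 ℕ) (L2 (Ball s))) :
    ‖deepIsometry hs n z‖ = ‖z‖ :=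
  (tensorIsometry (orthonormal_translates hs n)).norm_map z

theorem deepIsometry_tmul (hs : 2 ≤ s) (n k : ℕ) (v : Ball s) :
    deepIsometry hs n (HilbertTensor.tmul (basisVec k) (basisVec v))
      = (serreShift s ^ k) (wanderingVec hs (deepBall n v)) :=
  tensorIsometry_tmul (orthonormal_translates hs n) k v

theorem deepIsometry_shift (hs : 2 ≤ s) (n : ℕ) :
    (serreShift s).comp (deepIsometry hs n)
      = (deepIsometry hs n).comp (opTensor unilateralShift 1) :=
  HilbertTensor.ext_tmul_basisVec fun k v => by
    rw [ContinuousLinearMap.comp_apply, ContinuousLinearMap.comp_apply, opTensor_tmul,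
      unilateralShift_basisVec, one_apply_eq_self, deepIsometry_tmul, deepIsometry_tmul, pow_succ']
    rfl

theorem deepIsometry_star_shift (hs : 2 ≤ s) (n : ℕ) :
    (star (serreShift s)).comp (deepIsometry hs n)
      = (deepIsometry hs n).comp (opTensor (star unilateralShift) 1) :=
  HilbertTensor.ext_tmul_basisVec fun k v => by
    rw [ContinuousLinearMap.comp_apply, ContinuousLinearMap.comp_apply, opTensor_tmul,
      one_apply_eq_self, deepIsometry_tmul]
    cases k with
    | zero =>
      rw [star_unilateralShift_basisVec_zero, ← HilbertTensor.mk_apply, map_zero,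
        LinearMap.zero_apply, map_zero]
      exact star_serreShift_wanderingVec hs _
    | succ k =>
      rw [star_unilateralShift_basisVec_succ, deepIsometry_tmul, pow_succ']
      exact congrArg (fun T : L2 (Ball s) →L[ℂ] L2 (Ball s) => T _) (star_serreShift_mul_self s)

theorem levelProj_pow_wanderingVec (hs : 2 ≤ s) {v : Ball s} {N : ℕ} (hv : N ≤ v.1) (k : ℕ) :
    levelProj s N ((serreShift s ^ k) (wanderingVec hs v))
      = (serreShift s ^ k) (wanderingVec hs v) := by
  induction k with
  | zero => exact levelProj_wanderingVec hs (hv.trans (Nat.le_succ _))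
  | succ k ih =>
    have e : (serreShift s ^ (k + 1)) (wanderingVec hs v)
        = serreShift s ((serreShift s ^ k) (wanderingVec hs v)) := by rw [pow_succ']; rfl
    rw [e, ← ih]
    exact congrArg (fun T : L2 (Ball s) →L[ℂ] L2 (Ball s) => T _)
      (levelProj_mul_shift_mul_levelProj N)

theorem levelProj_comp_deepIsometry (hs : 2 ≤ s) (n : ℕ) :
    (levelProj s n).comp (deepIsometry hs n) = deepIsometry hs n :=
  HilbertTensor.ext_tmul_basisVec fun k v => by
    rw [ContinuousLinearMap.comp_apply, deepIsometry_tmul]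
    exact levelProj_pow_wanderingVec hs (Nat.le_add_right _ _) k

/-- The deep ball has level at least `n`, so `f` is constant on its children with value `f(x)`. The
wandering vector is an eigenvector of `M_f`, and applying `W` keeps the eigenvalue because `M_f`
commutes with `W` on these levels. -/
theorem deepIsometry_mulRep (hs : 2 ≤ s) {f : C(SAdic s, ℂ)} {n : ℕ} (hf : DependsOnDigits f n) :
    (mulRep s f).comp (deepIsometry hs n)
      = (deepIsometry hs n).comp (opTensor 1 (mulRep s f)) := by
  refine HilbertTensor.ext_tmul_basisVec fun k v => ?_
  have hlev : n ≤ (deepBall n v).1 := Nat.le_add_right _ _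
  have key : mulOp s f ((serreShift s ^ k) (wanderingVec hs (deepBall n v)))
      = f (SAdic.ofNat s v.2) • (serreShift s ^ k) (wanderingVec hs (deepBall n v)) := by
    induction k with
    | zero => exact mulOp_wanderingVec hs hf hlev
    | succ k ih =>
      have e : (serreShift s ^ (k + 1)) (wanderingVec hs (deepBall n v))
          = serreShift s (levelProj s n ((serreShift s ^ k) (wanderingVec hs (deepBall n v)))) := by
        rw [levelProj_pow_wanderingVec hs hlev, pow_succ']
        rfl
      have h1 := congrArg (fun T : L2 (Ball s) →L[ℂ] L2 (Ball s) =>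
        T ((serreShift s ^ k) (wanderingVec hs (deepBall n v)))) (mulRep_mul_shift_mul_levelProj hf)
      change mulOp s f (serreShift s (levelProj s n _))
        = serreShift s (levelProj s n (mulOp s f _)) at h1
      rw [e, h1, ih, map_smul, map_smul]
  have h2 : mulRep s f (basisVec v) = f (SAdic.ofNat s v.2) • basisVec v := mulOp_basisVec s f v
  have h3 : HilbertTensor.tmul (basisVec k : L2 ℕ) (f (SAdic.ofNat s v.2) • basisVec v : L2 (Ball s))
      = f (SAdic.ofNat s v.2) • HilbertTensor.tmul (basisVec k) (basisVec v) :=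
    (HilbertTensor.mk (basisVec k : L2 ℕ)).map_smul _ _
  rw [ContinuousLinearMap.comp_apply, ContinuousLinearMap.comp_apply, opTensor_tmul,
    one_apply_eq_self, h2, h3, map_smul, deepIsometry_tmul]
  exact key

/-- The range of `V_n` lies in the levels at least `n`, where a compact operator is small in norm.
-/
theorem tendsto_norm_comp_deepIsometry (hs : 2 ≤ s) {c : L2 (Ball s) →L[ℂ] L2 (Ball s)}
    (hc : IsCompactOperator c) :
    Filter.Tendsto (fun n => ‖c.comp (deepIsometry hs n)‖) Filter.atTop (nhds 0) := by
  refine squeeze_zero (fun _ => norm_nonneg _) (fun n => ?_) (tendsto_norm_mul_levelProj hc)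
  rw [← levelProj_comp_deepIsometry]
  refine ContinuousLinearMap.opNorm_le_bound _ (norm_nonneg _) fun z => ?_
  rw [← norm_deepIsometry hs n z]
  exact (c * levelProj s n).le_opNorm _

end SerreWandering

/-! ### Isometric identification of a quotient -/

section QuotientIsomorphism

variable {A B : Type*} [NormedRing A] [StarRing A] [NormedAlgebra ℂ A] [CompleteSpace A]
  [NormedRing B] [StarRing B] [NormedAlgebra ℂ B] (I : Ideal A) [I.IsTwoSided] [IsStarIdeal I]

/-- A contractive `*`-homomorphism with dense range that induces the quotient norm identifies the
quotient isometrically with its target. -/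
theorem exists_isometric_starAlgEquiv_quotient (hI : IsClosed (I : Set A)) (φ : A →⋆ₐ[ℂ] B)
    (hker : ∀ a ∈ I, φ a = 0) (hle : ∀ a, ‖φ a‖ ≤ ‖a‖)
    (hge : ∀ a, ∀ ε > 0, ∃ c ∈ I, ‖a + c‖ ≤ ‖φ a‖ + ε) (hdense : DenseRange φ) :
    ∃ e : (A ⧸ I) ≃⋆ₐ[ℂ] B, ∀ x, ‖e x‖ = ‖x‖ := by
  have hnorm : ∀ a, ‖φ a‖ = ‖(Submodule.Quotient.mk a : A ⧸ I)‖ := by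
    intro a
    refine le_antisymm (le_of_forall_pos_le_add fun ε hε => ?_)
      (le_of_forall_pos_le_add fun ε hε => ?_)
    · obtain ⟨m, hm, hlt⟩ := Submodule.Quotient.norm_mk_lt (Submodule.Quotient.mk a : A ⧸ I) hε
      have h0 := hker _ ((Submodule.Quotient.eq I).mp hm)
      rw [map_sub, sub_eq_zero] at h0
      rw [← h0]
      exact (hle m).trans hlt.le
    · obtain ⟨c, hc, hle'⟩ := hge a ε hε
      have h0 : (Submodule.Quotient.mk a : A ⧸ I) = Submodule.Quotient.mk (a + c) := by
        rw [Submodule.Quotient.eq, sub_add_cancel_left]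
        exact I.neg_mem hc
      rw [h0]
      exact (Submodule.Quotient.norm_mk_le I _).trans hle'
  let g : A ⧸ I →+* B := Ideal.Quotient.lift I (φ : A →+* B) hker
  have hg : ∀ a, g (Ideal.Quotient.mk I a) = φ a := fun a => Ideal.Quotient.lift_mk I _ hker
  have hgnorm : ∀ x, ‖g x‖ = ‖x‖ := by
    intro x
    obtain ⟨a, rfl⟩ := Ideal.Quotient.mk_surjective x
    rw [hg, hnorm]
    rfl
  have hiso : Isometry g := AddMonoidHomClass.isometry_of_norm g hgnorm
  have hinj : Function.Injective g := by
    rw [injective_iff_map_eq_zero]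
    intro x hx
    obtain ⟨a, rfl⟩ := Ideal.Quotient.mk_surjective x
    rw [hg] at hx
    -- When `φ a = 0`, the bound `hge` puts elements of `I` arbitrarily close to `a`, and `I` is
    -- closed.
    rw [Ideal.Quotient.eq_zero_iff_mem, ← SetLike.mem_coe, ← hI.closure_eq, Metric.mem_closure_iff]
    intro ε hε
    obtain ⟨c, hc, h⟩ := hge a (ε / 2) (by positivity)
    refine ⟨-c, I.neg_mem hc, ?_⟩
    rw [hx, norm_zero] at h
    rw [dist_eq_norm, sub_neg_eq_add]
    linarith
  have hrange : Set.range g = Set.univ := by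
    have hcl : IsClosed (Set.range g) := by
      -- The quotient of the complete `A` is complete, so its isometric image is closed; being
      -- dense, it is everything.
      have hu : IsUniformInducing g := hiso.isUniformInducing
      exact (hu.isComplete_range).isClosed
    rw [← hcl.closure_eq]
    refine (hdense.mono ?_).closure_eq
    rintro _ ⟨a, rfl⟩
    exact ⟨Ideal.Quotient.mk I a, hg a⟩
  have hsurj : Function.Surjective g := Set.range_eq_univ.mp hrange
  let E := RingEquiv.ofBijective g ⟨hinj, hsurj⟩
  refine ⟨{ E with map_star' := ?_, map_smul' := ?_ }, hgnorm⟩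
  · intro x
    obtain ⟨a, rfl⟩ := Ideal.Quotient.mk_surjective x
    change g (star (Ideal.Quotient.mk I a)) = star (g (Ideal.Quotient.mk I a))
    rw [quotient_star_mk, hg, hg, map_star]
  · intro c x
    obtain ⟨a, rfl⟩ := Ideal.Quotient.mk_surjective x
    change g (Ideal.Quotient.mk I (c • a)) = c • g (Ideal.Quotient.mk I a)
    rw [hg, hg, map_smul]

end QuotientIsomorphism

/-! ### The graph of the symbol map and its two norm bounds -/

section SymbolAlgebra

variable {s : ℕ} [NeZero s]

variable (s) in
/-- The generators `(W, S ⊗ 1)` and `(M_f, 1 ⊗ M_f)`, for locally constant `f`, of the graph of the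
symbol map. -/
def symbolGenerators : Set ((L2 (Ball s) →L[ℂ] L2 (Ball s)) ×
    (HilbertTensor (L2 ℕ) (L2 (Ball s)) →L[ℂ] HilbertTensor (L2 ℕ) (L2 (Ball s)))) :=
  {(serreShift s, opTensor unilateralShift 1)} ∪
    (fun f => (mulRep s f, opTensor 1 (mulRep s f))) '' (locallyConstant s : Set C(SAdic s, ℂ))

variable (s) in
/-- The dense `*`-subalgebra of the graph of the symbol map. -/
def symbolAlgebra : StarSubalgebra ℂ ((L2 (Ball s) →L[ℂ] L2 (Ball s)) ×
    (HilbertTensor (L2 ℕ) (L2 (Ball s)) →L[ℂ] HilbertTensor (L2 ℕ) (L2 (Ball s)))) :=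
  StarAlgebra.adjoin ℂ (symbolGenerators s)

/-- The locally constant functions are closed under conjugation, so the adjoints of the generators
add only the case of `W*`. -/
theorem symbolAlgebra_induction
    {P : (L2 (Ball s) →L[ℂ] L2 (Ball s)) →
      (HilbertTensor (L2 ℕ) (L2 (Ball s)) →L[ℂ] HilbertTensor (L2 ℕ) (L2 (Ball s))) → Prop}
    (shift : P (serreShift s) (opTensor unilateralShift 1))
    (star_shift : P (star (serreShift s)) (opTensor (star unilateralShift) 1))
    (mulRep : ∀ f ∈ locallyConstant s, P (mulRep s f) (opTensor 1 (mulRep s f)))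
    (smul_one : ∀ c : ℂ, P (c • 1) (c • 1))
    (add : ∀ a b y z, P a y → P b z → P (a + b) (y + z))
    (mul : ∀ a b y z, P a y → P b z → P (a * b) (y * z))
    {p} (hp : p ∈ symbolAlgebra s) : P p.1 p.2 := by
  change p ∈ Algebra.adjoin ℂ (symbolGenerators s ∪ star (symbolGenerators s)) at hp
  induction hp using Algebra.adjoin_induction with
  | mem p hp =>
    rcases hp with (hp | ⟨f, hf, rfl⟩) | hp
    · rw [Set.mem_singleton_iff.mp hp]
      exact shift
    · exact mulRep f hf
    · rw [← star_star p]
      rcases Set.mem_star.mp hp with hp | ⟨f, hf, hp⟩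
      · rw [Set.mem_singleton_iff.mp hp]
        change P (star (serreShift s)) (star (opTensor unilateralShift 1))
        rw [star_opTensor, star_one]
        exact star_shift
      · rw [← hp]
        change P (star (_root_.mulRep s f)) (star (opTensor 1 (_root_.mulRep s f)))
        rw [star_opTensor, star_one, ← map_star]
        exact mulRep _ (star_mem hf)
  | algebraMap c =>
    rw [Algebra.algebraMap_eq_smul_one]
    exact smul_one c
  | add p q _ _ hp hq => exact add _ _ _ _ hp hq
  | mul p q _ _ hp hq => exact mul _ _ _ _ hp hq

/-- How large `n` must be depends on the digits seen by the functions that occur in `p`; only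
finitely many occur, so "eventually" survives sums and products. -/
theorem symbolAlgebra_intertwines_deepIsometry (hs : 2 ≤ s) {p} (hp : p ∈ symbolAlgebra s) :
    ∀ᶠ n in Filter.atTop, p.1.comp (deepIsometry hs n) = (deepIsometry hs n).comp p.2 := by
  refine symbolAlgebra_induction (P := fun a y => ∀ᶠ n in Filter.atTop,
    a.comp (deepIsometry hs n) = (deepIsometry hs n).comp y) ?_ ?_ ?_ ?_ ?_ ?_ hp
  · exact Filter.Eventually.of_forall fun n => deepIsometry_shift hs n
  · exact Filter.Eventually.of_forall fun n => deepIsometry_star_shift hs n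
  · rintro f ⟨N, hf⟩
    filter_upwards [Filter.eventually_ge_atTop N] with n hn
    exact deepIsometry_mulRep hs (hf.mono hn)
  · intro c
    refine Filter.Eventually.of_forall fun n => ContinuousLinearMap.ext fun z => ?_
    simp
  · intro a b y z ha hb
    filter_upwards [ha, hb] with n ha hb
    rw [ContinuousLinearMap.add_comp, ContinuousLinearMap.comp_add, ha, hb]
  · intro a b y z ha hb
    filter_upwards [ha, hb] with n ha hb
    change (a.comp b).comp _ = (deepIsometry hs n).comp (y.comp z)
    rw [ContinuousLinearMap.comp_assoc, hb, ← ContinuousLinearMap.comp_assoc, ha,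
      ContinuousLinearMap.comp_assoc]

/-- For `(a, y)` in the dense subalgebra and large `n`, `‖y z‖ = ‖V_n y z‖ = ‖a V_n z‖`. This is at
most `‖(a + c) V_n z‖ + ‖c V_n‖ ‖z‖`, and the last term tends to zero. With `c` fixed the inequality
is a closed condition on the pair. -/
theorem norm_snd_le_norm_fst_add (hs : 2 ≤ s) {c : L2 (Ball s) →L[ℂ] L2 (Ball s)}
    (hc : c ∈ serreIdealAlgebra s) {p} (hp : p ∈ (symbolAlgebra s).topologicalClosure) :
    ‖p.2‖ ≤ ‖p.1 + c‖ := by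
  refine closure_minimal (t := {p | ‖p.2‖ ≤ ‖p.1 + c‖}) (fun q hq => ?_)
    (isClosed_le (by fun_prop) (by fun_prop)) hp
  refine ContinuousLinearMap.opNorm_le_bound _ (norm_nonneg _) fun z => ?_
  have hlim : Filter.Tendsto
      (fun n => ‖q.1 + c‖ * ‖z‖ + ‖c.comp (deepIsometry hs n)‖ * ‖z‖) Filter.atTop
      (nhds (‖q.1 + c‖ * ‖z‖ + 0 * ‖z‖)) :=
    tendsto_const_nhds.add ((tendsto_norm_comp_deepIsometry hs
      (isCompactOperator_of_mem_serreIdealAlgebra hc)).mul_const _)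
  rw [zero_mul, add_zero] at hlim
  refine ge_of_tendsto hlim ?_
  filter_upwards [symbolAlgebra_intertwines_deepIsometry hs hq] with n hn
  have e : deepIsometry hs n (q.2 z)
      = (q.1 + c) (deepIsometry hs n z) - (c.comp (deepIsometry hs n)) z := by
    have := congrArg (fun T => T z) hn
    change q.1 (deepIsometry hs n z) = deepIsometry hs n (q.2 z) at this
    rw [← this, _root_.add_apply, ContinuousLinearMap.comp_apply, add_sub_cancel_right]
  rw [← norm_deepIsometry hs n (q.2 z), e]
  refine (norm_sub_le _ _).trans (add_le_add ?_ (ContinuousLinearMap.le_opNorm _ _))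
  rw [← norm_deepIsometry hs n z]
  exact ContinuousLinearMap.le_opNorm _ _

theorem mul_mem_serreIdealAlgebra {x b : L2 (Ball s) →L[ℂ] L2 (Ball s)}
    (hx : x ∈ serreIdealAlgebra s) (hb : b ∈ serreAlgebra s) : x * b ∈ serreIdealAlgebra s := by
  have h := star_mem (serreAlgebra_mul_mem (star_mem hb) (star_mem hx))
  rwa [star_mul, star_star, star_star] at h

theorem isInvariantProjection_levelProj (N : ℕ) :
    IsInvariantProjection (serreShift s) (levelProj s N) where
  isometry := star_serreShift_mul_self s
  star_eq := star_levelProj N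
  mul_self := levelProj_mul_self N
  invariant := levelProj_mul_shift_mul_levelProj N
  pure := tendsto_star_serreShift_pow

/-- Of the generators and their adjoints only `W` needs a correction, which turns it into `W P_N`.
Membership in `A_W` is carried along because a product brings terms such as `a * d`, which lie in
the ideal only if `a` is in `A_W`. -/
theorem symbolAlgebra_intertwines_wold {p} (hp : p ∈ symbolAlgebra s) :
    p.1 ∈ serreAlgebra s ∧ ∀ᶠ N in Filter.atTop, ∃ c ∈ serreIdealAlgebra s, ∀ ξ,
      (isInvariantProjection_levelProj N).wold ((p.1 + c) ξ)
        = p.2 ((isInvariantProjection_levelProj N).wold ξ) := by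
  refine symbolAlgebra_induction (P := fun a y => a ∈ serreAlgebra s ∧ ∀ᶠ N in Filter.atTop,
    ∃ c ∈ serreIdealAlgebra s, ∀ ξ, (isInvariantProjection_levelProj N).wold ((a + c) ξ)
      = y ((isInvariantProjection_levelProj N).wold ξ)) ?_ ?_ ?_ ?_ ?_ ?_ hp
  · refine ⟨serreShift_mem_serreAlgebra, Filter.Eventually.of_forall fun N =>
      ⟨-(serreShift s * (1 - levelProj s N)), neg_mem (shift_mul_mem
        (one_sub_levelProj_mem_serreIdealAlgebra N)), fun ξ => ?_⟩⟩
    have e : serreShift s + -(serreShift s * (1 - levelProj s N)) = serreShift s * levelProj s N := by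
      noncomm_ring
    rw [e]
    exact (isInvariantProjection_levelProj N).wold_isometry ξ
  · refine ⟨star_mem serreShift_mem_serreAlgebra, Filter.Eventually.of_forall fun N =>
      ⟨0, zero_mem _, fun ξ => ?_⟩⟩
    rw [add_zero]
    exact (isInvariantProjection_levelProj N).wold_star_isometry ξ
  · rintro f ⟨M, hf⟩
    refine ⟨mulRep_mem_serreAlgebra f, ?_⟩
    filter_upwards [Filter.eventually_ge_atTop M] with N hN
    refine ⟨0, zero_mem _, fun ξ => ?_⟩
    have hf' : DependsOnDigits (star f) N := fun x y hxy => congrArg star (hf.mono hN x y hxy)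
    rw [add_zero]
    refine (isInvariantProjection_levelProj N).wold_commutant (mulRep_mul_levelProj f N)
      (mulRep_mul_shift_mul_levelProj (hf.mono hN)) ?_ ξ
    rw [← map_star]
    exact mulRep_mul_shift_mul_levelProj hf'
  · intro c
    refine ⟨(serreAlgebra s).smul_mem (one_mem _) c, Filter.Eventually.of_forall fun N =>
      ⟨0, zero_mem _, fun ξ => ?_⟩⟩
    simp
  · rintro a b y z ⟨ha, ha'⟩ ⟨hb, hb'⟩
    refine ⟨add_mem ha hb, ?_⟩
    filter_upwards [ha', hb'] with N ⟨c, hc, h1⟩ ⟨d, hd, h2⟩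
    refine ⟨c + d, add_mem hc hd, fun ξ => ?_⟩
    rw [add_add_add_comm, _root_.add_apply, map_add, h1, h2, _root_.add_apply]
  · rintro a b y z ⟨ha, ha'⟩ ⟨hb, hb'⟩
    refine ⟨mul_mem ha hb, ?_⟩
    filter_upwards [ha', hb'] with N ⟨c, hc, h1⟩ ⟨d, hd, h2⟩
    -- The correction is `(a + c) (b + d) - a b`.
    refine ⟨a * d + (c * b + c * d), add_mem (serreAlgebra_mul_mem ha hd)
      (add_mem (mul_mem_serreIdealAlgebra hc hb) (mul_mem hc hd)), fun ξ => ?_⟩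
    have e : a * b + (a * d + (c * b + c * d)) = (a + c) * (b + d) := by noncomm_ring
    rw [e]
    change (isInvariantProjection_levelProj N).wold ((a + c) ((b + d) ξ)) = _
    rw [h1, h2]
    rfl

/-- Compressing `a + c` by `P_N` changes it by an element of the ideal, and the norm of `P_N (a + c)
ξ` is that of its Wold image `y (wold ξ)`, where `wold ξ` has norm `‖P_N ξ‖ ≤ ‖ξ‖`. -/
theorem exists_norm_fst_add_le {p} (hp : p ∈ symbolAlgebra s) :
    ∃ c ∈ serreIdealAlgebra s, ‖p.1 + c‖ ≤ ‖p.2‖ := by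
  obtain ⟨ha, hev⟩ := symbolAlgebra_intertwines_wold hp
  obtain ⟨N, c, hc, h⟩ := hev.exists
  have hsub := one_sub_levelProj_mem_serreIdealAlgebra (s := s) N
  refine ⟨c - ((1 - levelProj s N) * p.1 + (1 - levelProj s N) * c),
    sub_mem hc (add_mem (mul_mem_serreIdealAlgebra hsub ha) (mul_mem hsub hc)), ?_⟩
  have e : p.1 + (c - ((1 - levelProj s N) * p.1 + (1 - levelProj s N) * c))
      = levelProj s N * (p.1 + c) := by noncomm_ring
  rw [e]
  refine ContinuousLinearMap.opNorm_le_bound _ (norm_nonneg _) fun ξ => ?_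
  change ‖levelProj s N ((p.1 + c) ξ)‖ ≤ _
  rw [← (isInvariantProjection_levelProj N).norm_wold, h]
  refine (ContinuousLinearMap.le_opNorm _ _).trans ?_
  rw [(isInvariantProjection_levelProj N).norm_wold]
  exact mul_le_mul_of_nonneg_left (norm_levelProj_apply_le N ξ) (norm_nonneg _)

/-- The correction `c` depends on the approximating pair and need not converge, so passing to the
closure costs `ε`: half in each coordinate. -/
theorem exists_norm_fst_add_le_add {p} (hp : p ∈ (symbolAlgebra s).topologicalClosure) {ε : ℝ}
    (hε : 0 < ε) : ∃ c ∈ serreIdealAlgebra s, ‖p.1 + c‖ ≤ ‖p.2‖ + ε := by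
  obtain ⟨q, hq, hd⟩ := Metric.mem_closure_iff.mp hp (ε / 2) (by positivity)
  obtain ⟨c, hc, h⟩ := exists_norm_fst_add_le hq
  refine ⟨c, hc, ?_⟩
  rw [dist_eq_norm] at hd
  have h1 : ‖p.1 - q.1‖ ≤ ‖p - q‖ := norm_fst_le (p - q)
  have h2 : ‖q.2 - p.2‖ ≤ ‖p - q‖ := by
    rw [norm_sub_rev]
    exact norm_snd_le (p - q)
  have h3 : p.1 + c = (p.1 - q.1) + (q.1 + c) := by abel
  have h4 : q.2 = (q.2 - p.2) + p.2 := by abel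
  have h5 := norm_add_le (p.1 - q.1) (q.1 + c)
  have h6 := norm_add_le (q.2 - p.2) p.2
  rw [← h4] at h6
  rw [h3]
  linarith

end SymbolAlgebra

/-! ### The symbol map -/

section SymbolMap

variable {s : ℕ} [NeZero s]

theorem shift_mem_symbolAlgebra :
    (serreShift s, opTensor unilateralShift 1) ∈ (symbolAlgebra s).topologicalClosure :=
  StarSubalgebra.le_topologicalClosure _ (StarAlgebra.subset_adjoin ℂ _ (Or.inl rfl))

theorem mulRep_mem_of_locallyConstant {E : Type*} [Semiring E] [StarRing E] [Algebra ℂ E]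
    [StarModule ℂ E] [TopologicalSpace E] {R : StarSubalgebra ℂ E} (hR : IsClosed (R : Set E))
    {ρ : C(SAdic s, ℂ) →⋆ₐ[ℂ] E} (hρ : Continuous ρ) (h : ∀ f ∈ locallyConstant s, ρ f ∈ R)
    (f : C(SAdic s, ℂ)) : ρ f ∈ R := by
  have hf : f ∈ (locallyConstant s).topologicalClosure := by
    rw [topologicalClosure_locallyConstant]
    trivial
  exact closure_minimal (t := ρ ⁻¹' (R : Set E)) h (hR.preimage hρ) hf

theorem continuous_mulRep : Continuous (mulRep s) :=
  AddMonoidHomClass.continuous_of_bound _ 1 fun f => by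
    rw [one_mul]
    exact NonUnitalStarAlgHom.norm_apply_le (mulRep s) f

/-- The second coordinate never exceeds the first in norm, so the first projection is isometric on
the complete graph and its image is complete. -/
theorem isClosed_map_fst_symbolAlgebra (hs : 2 ≤ s) :
    IsClosed ((((symbolAlgebra s).topologicalClosure).map (StarAlgHom.fst ℂ _ _) :
      StarSubalgebra ℂ (L2 (Ball s) →L[ℂ] L2 (Ball s))) :
        Set (L2 (Ball s) →L[ℂ] L2 (Ball s))) := by
  let G := (symbolAlgebra s).topologicalClosure
  have hcomp : IsComplete (G : Set ((L2 (Ball s) →L[ℂ] L2 (Ball s)) ×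
      (HilbertTensor (L2 ℕ) (L2 (Ball s)) →L[ℂ] HilbertTensor (L2 ℕ) (L2 (Ball s))))) :=
    (StarSubalgebra.isClosed_topologicalClosure (symbolAlgebra s)).isComplete
  have hnorm : ∀ p ∈ G, ‖p‖ = ‖p.1‖ := fun p hp => by
    rw [Prod.norm_def, max_eq_left]
    simpa using norm_snd_le_norm_fst_add hs (zero_mem (serreIdealAlgebra s)) hp
  have hiso : Isometry (fun p : G => p.1.1) := Isometry.of_dist_eq fun p q => by
    rw [Subtype.dist_eq, dist_eq_norm, dist_eq_norm]
    exact (hnorm _ (sub_mem p.2 q.2)).symm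
  have : CompleteSpace G := hcomp.completeSpace_coe
  have h := (hiso.isUniformInducing.isComplete_range).isClosed
  refine (congrArg IsClosed (Set.ext fun a => ⟨?_, ?_⟩)).mpr h
  · rintro ⟨p, hp, rfl⟩
    exact ⟨⟨p, hp⟩, rfl⟩
  · rintro ⟨p, rfl⟩
    exact ⟨p.1, p.2, rfl⟩

/-- The domain of the closed graph is a closed `*`-algebra containing `W` and, by density of the
locally constant functions, every `M_f`. -/
theorem exists_symbol (hs : 2 ≤ s) {a : L2 (Ball s) →L[ℂ] L2 (Ball s)} (ha : a ∈ serreAlgebra s) :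
    ∃ y, (a, y) ∈ (symbolAlgebra s).topologicalClosure := by
  have hcl := isClosed_map_fst_symbolAlgebra hs
  have hle : serreAlgebra s ≤ ((symbolAlgebra s).topologicalClosure).map (StarAlgHom.fst ℂ _ _) := by
    refine StarSubalgebra.topologicalClosure_minimal (StarAlgebra.adjoin_le ?_) hcl
    rintro _ (h | ⟨f, rfl⟩)
    · rw [Set.mem_singleton_iff.mp h]
      exact ⟨_, shift_mem_symbolAlgebra, rfl⟩
    · refine mulRep_mem_of_locallyConstant hcl continuous_mulRep (fun f hf => ?_) f
      exact ⟨_, StarSubalgebra.le_topologicalClosure _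
        (StarAlgebra.subset_adjoin ℂ _ (Or.inr ⟨f, hf, rfl⟩)), rfl⟩
  obtain ⟨p, hp, rfl⟩ := hle ha
  exact ⟨p.2, hp⟩

/-- The graph is linear, so the difference `(0, y - z)` lies in it and the norm bound forces `y =
z`. Every algebraic property of the symbol map follows from this uniqueness. -/
theorem symbol_unique (hs : 2 ≤ s) {a : L2 (Ball s) →L[ℂ] L2 (Ball s)}
    {y z : HilbertTensor (L2 ℕ) (L2 (Ball s)) →L[ℂ] HilbertTensor (L2 ℕ) (L2 (Ball s))}
    (hy : (a, y) ∈ (symbolAlgebra s).topologicalClosure)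
    (hz : (a, z) ∈ (symbolAlgebra s).topologicalClosure) : y = z := by
  have h := norm_snd_le_norm_fst_add hs (zero_mem (serreIdealAlgebra s)) (sub_mem hy hz)
  simpa [sub_eq_zero] using h

theorem isClosed_spatialTensorProduct :
    IsClosed (spatialTensorProduct toeplitzAlgebra.subtype (mulRep s) :
      Set (HilbertTensor (L2 ℕ) (L2 (Ball s)) →L[ℂ] HilbertTensor (L2 ℕ) (L2 (Ball s)))) :=
  StarSubalgebra.isClosed_topologicalClosure _

theorem opTensor_mem_spatialTensorProduct {t : L2 ℕ →L[ℂ] L2 ℕ} (ht : t ∈ toeplitzAlgebra)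
    (f : C(SAdic s, ℂ)) :
    opTensor t (mulRep s f) ∈ spatialTensorProduct toeplitzAlgebra.subtype (mulRep s) :=
  StarSubalgebra.le_topologicalClosure _ (StarAlgebra.subset_adjoin ℂ _ ⟨(⟨t, ht⟩, f), rfl⟩)

theorem unilateralShift_mem_toeplitzAlgebra : unilateralShift ∈ toeplitzAlgebra :=
  StarSubalgebra.le_topologicalClosure _ (StarAlgebra.subset_adjoin ℂ _ rfl)

theorem snd_mem_spatialTensorProduct {p} (hp : p ∈ (symbolAlgebra s).topologicalClosure) :
    p.2 ∈ spatialTensorProduct toeplitzAlgebra.subtype (mulRep s) := by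
  have hle : symbolAlgebra s ≤ (spatialTensorProduct toeplitzAlgebra.subtype (mulRep s)).comap
      (StarAlgHom.snd ℂ _ _) := by
    refine StarAlgebra.adjoin_le ?_
    rintro _ (h | ⟨f, -, rfl⟩)
    · rw [Set.mem_singleton_iff.mp h]
      change opTensor unilateralShift 1 ∈ spatialTensorProduct _ _
      rw [← map_one (mulRep s)]
      exact opTensor_mem_spatialTensorProduct unilateralShift_mem_toeplitzAlgebra 1
    · exact opTensor_mem_spatialTensorProduct (one_mem toeplitzAlgebra) f
  exact closure_minimal (t := Prod.snd ⁻¹' (spatialTensorProduct toeplitzAlgebra.subtype (mulRep s) :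
    Set (HilbertTensor (L2 ℕ) (L2 (Ball s)) →L[ℂ] HilbertTensor (L2 ℕ) (L2 (Ball s))))) hle
    (isClosed_spatialTensorProduct.preimage continuous_snd) hp

/-- The spatial tensor product of the Toeplitz algebra and `C(ℤ_s)` is generated by `S ⊗ 1` and the
`1 ⊗ M_f`, for locally constant `f`. -/
theorem spatialTensorProduct_le
    {R : StarSubalgebra ℂ (HilbertTensor (L2 ℕ) (L2 (Ball s)) →L[ℂ]
      HilbertTensor (L2 ℕ) (L2 (Ball s)))}
    (hR : IsClosed (R : Set (HilbertTensor (L2 ℕ) (L2 (Ball s)) →L[ℂ]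
      HilbertTensor (L2 ℕ) (L2 (Ball s)))))
    (hshift : opTensor unilateralShift 1 ∈ R)
    (hmul : ∀ f ∈ locallyConstant s, opTensor 1 (mulRep s f) ∈ R) :
    spatialTensorProduct toeplitzAlgebra.subtype (mulRep s) ≤ R := by
  have hleft : ∀ t ∈ toeplitzAlgebra, amplifyLeft t ∈ R := by
    have hle : StarAlgebra.adjoin ℂ {unilateralShift} ≤ R.comap amplifyLeft := by
      refine StarAlgebra.adjoin_le ?_
      rintro _ h
      rw [Set.mem_singleton_iff.mp h]
      exact hshift
    exact fun t ht => closure_minimal hle (hR.preimage continuous_amplifyLeft) ht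
  have hright : ∀ f, amplifyRight (mulRep s f) ∈ R := fun f =>
    mulRep_mem_of_locallyConstant (ρ := amplifyRight.comp (mulRep s)) hR
      (continuous_amplifyRight.comp continuous_mulRep) hmul f
  refine StarSubalgebra.topologicalClosure_minimal (StarAlgebra.adjoin_le ?_) hR
  rintro _ ⟨⟨t, f⟩, rfl⟩
  change opTensor (t : L2 ℕ →L[ℂ] L2 ℕ) (mulRep s f) ∈ R
  rw [← amplifyLeft_mul_amplifyRight]
  exact mul_mem (hleft t t.2) (hright f)

/-- The value of the symbol map. -/
def symbol (hs : 2 ≤ s) (a : serreAlgebra s) :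
    HilbertTensor (L2 ℕ) (L2 (Ball s)) →L[ℂ] HilbertTensor (L2 ℕ) (L2 (Ball s)) :=
  (exists_symbol hs a.2).choose

theorem symbol_spec (hs : 2 ≤ s) (a : serreAlgebra s) :
    ((a : L2 (Ball s) →L[ℂ] L2 (Ball s)), symbol hs a) ∈ (symbolAlgebra s).topologicalClosure :=
  (exists_symbol hs a.2).choose_spec

theorem symbol_star (hs : 2 ≤ s) (a : serreAlgebra s) :
    symbol hs (star a) = star (symbol hs a) := by
  have h : star ((a : L2 (Ball s) →L[ℂ] L2 (Ball s)), symbol hs a)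
      ∈ (symbolAlgebra s).topologicalClosure := star_mem (symbol_spec hs a)
  exact symbol_unique hs (symbol_spec hs (star a)) h

theorem symbol_smul_one (hs : 2 ≤ s) (c : ℂ) :
    symbol hs (c • (1 : serreAlgebra s)) = c • 1 :=
  symbol_unique hs (symbol_spec hs (c • 1))
    ((symbolAlgebra s).topologicalClosure.smul_mem (one_mem _) c)

/-- The symbol map `A_W → 𝒯 ⊗ C(ℤ_s)`. -/
def symbolHom (hs : 2 ≤ s) :
    serreAlgebra s →⋆ₐ[ℂ] spatialTensorProduct toeplitzAlgebra.subtype (mulRep s) where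
  toFun a := ⟨symbol hs a, snd_mem_spatialTensorProduct (symbol_spec hs a)⟩
  map_one' := Subtype.ext (symbol_unique hs (symbol_spec hs 1) (one_mem _))
  map_mul' a b := Subtype.ext (symbol_unique hs (symbol_spec hs (a * b))
    (mul_mem (symbol_spec hs a) (symbol_spec hs b)))
  map_zero' := Subtype.ext (symbol_unique hs (symbol_spec hs 0) (zero_mem _))
  map_add' a b := Subtype.ext (symbol_unique hs (symbol_spec hs (a + b))
    (add_mem (symbol_spec hs a) (symbol_spec hs b)))
  commutes' c := by
    rw [Algebra.algebraMap_eq_smul_one, Algebra.algebraMap_eq_smul_one]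
    exact Subtype.ext (symbol_smul_one hs c)
  map_star' a := Subtype.ext (symbol_star hs a)

/-- Second coordinates of the unclosed graph are values of the symbol map, and they contain
generators of the tensor product. -/
theorem denseRange_symbolHom (hs : 2 ≤ s) : DenseRange (symbolHom hs) := by
  let R : StarSubalgebra ℂ (HilbertTensor (L2 ℕ) (L2 (Ball s)) →L[ℂ]
      HilbertTensor (L2 ℕ) (L2 (Ball s))) :=
    ((symbolAlgebra s).map (StarAlgHom.snd ℂ _ _)).topologicalClosure
  have hle : spatialTensorProduct toeplitzAlgebra.subtype (mulRep s) ≤ R := by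
    refine spatialTensorProduct_le (StarSubalgebra.isClosed_topologicalClosure _) ?_ ?_
    · exact StarSubalgebra.le_topologicalClosure _
        ⟨_, StarAlgebra.subset_adjoin ℂ _ (Or.inl rfl), rfl⟩
    · exact fun f hf => StarSubalgebra.le_topologicalClosure _
        ⟨_, StarAlgebra.subset_adjoin ℂ _ (Or.inr ⟨f, hf, rfl⟩), rfl⟩
  refine Subtype.dense_iff.mpr fun y hy => closure_mono ?_ (hle hy)
  rintro _ ⟨p, hp, rfl⟩
  have hp1 := (symbolAlgebra_intertwines_wold hp).1
  refine ⟨symbolHom hs ⟨p.1, hp1⟩, ⟨_, rfl⟩, ?_⟩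
  exact symbol_unique hs (symbol_spec hs ⟨p.1, hp1⟩) (StarSubalgebra.le_topologicalClosure _ hp)

theorem isClosed_serreIdeal : IsClosed (serreIdeal s : Set (serreAlgebra s)) :=
  (NonUnitalStarSubalgebra.isClosed_topologicalClosure _).preimage continuous_subtype_val

end SymbolMap

end

set_option synthInstance.maxHeartbeats 400000 in
theorem proposition7p2 (s : ℕ) [NeZero s] (hs : 2 ≤ s) :
    serreIdealAlgebra s ≤ (serreAlgebra s).toNonUnitalStarSubalgebra ∧
      ∃ e : (serreAlgebra s ⧸ serreIdeal s) ≃⋆ₐ[ℂ]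
          spatialTensorProduct toeplitzAlgebra.subtype (mulRep s),
        ∀ x, ‖e x‖ = ‖x‖ := by
  have : CompleteSpace (serreAlgebra s) := isClosed_serreAlgebra.isComplete.completeSpace_coe
  refine ⟨serreIdealAlgebra_le_serreAlgebra hs,
    exists_isometric_starAlgEquiv_quotient (serreIdeal s) isClosed_serreIdeal (symbolHom hs)
      (fun a ha => ?_) (fun a => ?_) (fun a ε hε => ?_) (denseRange_symbolHom hs)⟩
  -- For `a` in the ideal the choice `c = -a` makes the right side of the lower bound zero.
  · have h := norm_snd_le_norm_fst_add hs (neg_mem (show (a : L2 (Ball s) →L[ℂ] L2 (Ball s)) ∈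
      serreIdealAlgebra s from ha)) (symbol_spec hs a)
    rw [add_neg_cancel, norm_zero] at h
    exact Subtype.ext (norm_le_zero_iff.mp h)
  · have h := norm_snd_le_norm_fst_add hs (zero_mem (serreIdealAlgebra s)) (symbol_spec hs a)
    rwa [add_zero] at h
  · obtain ⟨c, hc, h⟩ := exists_norm_fst_add_le_add (symbol_spec hs a) hε
    exact ⟨⟨c, serreIdealAlgebra_le_serreAlgebra hs hc⟩, hc, h⟩
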